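/- **Lemma 3.4.** Let $q,r\ge 1$ be integers. On the semi-infinite wedge space, with fermions $\psi_k,\psi_k^*$ ($k\in\mathbb{Z}+\frac12$), vacuum expectation $\langle\cdot\rangle$, $\alpha_m=\sum_k\psi_{k-m}\psi_k^*$ for $m\neq 0$, and $\mathcal F_{r+1}=\sum_k k^{r+1}{:}\psi_k\psi_k^*{:}$, let, for positive integers $\mu_1,\dots,\mu_n$ with $n\ge1$ and for $b\ge 0$, $$h^{\bullet}_{b;\mu}=\Big\langle \frac{\alpha_q^{|\mu|/q}}{q^{|\mu|/q}(|\mu|/q)!}\,\frac{\mathcal F_{r+1}^b}{(r+1)^b}\prod_{i=1}^{n}\frac{\alpha_{-\mu_i}}{\mu_i}\Big\rangle$$ (zero if $q\nmid|\mu|$), and let the connected numbers $h^\circ_{b;\mu}$ be obtained from these by inclusion-exclusion, so that $$\frac{h^\circ_{b;\mu}}{b!}=\sum_{P}(-1)^{|P|-1}(|P|-1)!\sum_{\sum_{B\in P} b_B=b}\ \prod_{B\in P}\frac{h^\bullet_{b_B;\mu_B}}{b_B!},$$ where $P$ runs over the set partitions of $\{1,\dots,n\}$ and the $b_B$ over nonnegative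 integers. For $g\ge0$ and $n\ge1$ put $$H_{g,n}(x_1,\dots,x_n)=\sum_{\mu_1,\dots,\mu_n\ge1}\frac{h^\circ_{b;\mu}}{b!}\,x_1^{\mu_1}\cdots x_n^{\mu_n},\qquad b=\frac{(2g-2+n)q+|\mu|}{qr},$$ the sum being over those $\mu$ for which $b$ is a nonnegative integer. Let $D_{x}=x\,\partial_x$ and $y(x)=D_xH_{0,1}(x)$, let $z(x)\in\mathbb{Q}[[x]]$ be the power series without constant term such that $x=z\,e^{-z^{qr}}$, let $t(x)\in\mathbb{Q}[[x]]$ be given by $\frac1t=y^r-\frac1{qr}$, and write $z_i=z(x_i)$, $y_i=y(x_i)$. Then, as formal power series, $$H_{0,2}(x_1,x_2)=\ln(z_1-z_2)-\ln(x_1-x_2)-y_1^r-y_2^r,$$ where the difference of the logarithms means $\ln\frac{z_1-z_2}{x_1-x_2}$, the quotient being a power series in $x_1,x_2$ with constant term $1$. Moreover $$W_{0,2}(x_1,x_2):=D_{x_1}D_{x_2}H_{0,2}(x_1,x_2)=\frac{(D_{x_1}z_1)(D_{x_2}z_2)}{(z_1-z_2)^2}-\frac{x_1x_2}{(x_1-x_2)^2}$$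 and, with $t=t(x)$, $$W_{0,2}(x,x)=\frac{3t^4+4qrt^3+(q^2r^2-1)t^2+q^2r^2}{12\,r^2q^2}.$$ -/

import Mathlib

namespace SpinHurwitz

noncomputable section

/-! ### The semi-infinite wedge space

Half-integers are encoded by integers: `s : ℤ` stands for the half-integer `s + 1/2`. -/

/-- The index set of the standard basis of the semi-infinite wedge space: the sets `S` of
half-integers containing finitely many positive ones and all but finitely many negative ones.
The set `S = {s₁ > s₂ > ⋯}` labels the basis vector `s₁ ∧ s₂ ∧ ⋯`. -/
def MayaDiagram : Type :=
  {S : Set ℤ // {s : ℤ | 0 ≤ s ∧ s ∈ S}.Finite ∧ {s : ℤ | s < 0 ∧ s ∉ S}.Finite}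

namespace MayaDiagram

/-- The vacuum: exactly the negative half-integers. -/
def vacuum : MayaDiagram :=
  ⟨{s | s < 0},
    Set.finite_empty.subset (fun _ hs => absurd hs.1 (not_le.2 hs.2)),
    Set.finite_empty.subset (fun _ hs => hs.2 hs.1)⟩

/-- Add the half-integer `k`. -/
def insert (k : ℤ) (S : MayaDiagram) : MayaDiagram :=
  ⟨Set.insert k S.1,
    (S.2.1.insert k).subset (fun _ hs => hs.2.elim Or.inl (fun h => Or.inr ⟨hs.1, h⟩)),
    S.2.2.subset (fun _ hs => ⟨hs.1, fun h => hs.2 (Or.inr h)⟩)⟩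

/-- Remove the half-integer `k`. -/
def erase (k : ℤ) (S : MayaDiagram) : MayaDiagram :=
  ⟨S.1 \ {k},
    S.2.1.subset (fun _ hs => ⟨hs.1, hs.2.1⟩),
    (S.2.2.insert k).subset (fun s hs => by
      by_cases h : s = k
      · exact Or.inl h
      · exact Or.inr ⟨hs.1, fun h' => hs.2 ⟨h', h⟩⟩)⟩

/-- The number of elements of `S` above `k` (always finite). -/
def above (k : ℤ) (S : MayaDiagram) : ℕ := {s : ℤ | s ∈ S.1 ∧ k < s}.ncard

/-- There really are only finitely many elements of `S` above `k`. -/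
theorem finite_above (k : ℤ) (S : MayaDiagram) : {s : ℤ | s ∈ S.1 ∧ k < s}.Finite := by
  refine (S.2.1.union (Set.finite_Ioo k 0)).subset (fun s hs => ?_)
  rcases le_or_gt 0 s with h | h
  · exact Or.inl ⟨h, hs.1⟩
  · exact Or.inr ⟨hs.2, h⟩

/-- The regularized power sum `∑_{k ∈ S, k > 0} k ^ m - ∑_{k ∉ S, k < 0} k ^ m`, over
half-integers `k`. -/
def powerSum (m : ℕ) (S : MayaDiagram) : ℚ :=
  ∑ s ∈ S.2.1.toFinset, ((s : ℚ) + 1 / 2) ^ m - ∑ s ∈ S.2.2.toFinset, ((s : ℚ) + 1 / 2) ^ m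

end MayaDiagram

/-- The semi-infinite wedge space. -/
abbrev Wedge : Type := MayaDiagram →₀ ℚ

open Classical in
/-- The creation operator `ψ_k`: exterior multiplication by `k` from the left. -/
def psi (k : ℤ) : Module.End ℚ Wedge :=
  Finsupp.linearCombination ℚ fun S : MayaDiagram =>
    if k ∈ S.1 then 0 else Finsupp.single (S.insert k) ((-1 : ℚ) ^ S.above k)

open Classical in
/-- The annihilation operator `ψ_k^*`: contraction with `k`. -/
def psiStar (k : ℤ) : Module.End ℚ Wedge :=
  Finsupp.linearCombination ℚ fun S : MayaDiagram =>
    if k ∈ S.1 then Finsupp.single (S.erase k) ((-1 : ℚ) ^ S.above k) else 0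

/-- On a basis vector, only finitely many terms `ψ_{k-n} ψ_k^*` act nontrivially if `n ≠ 0`. -/
theorem finite_support_psi_psiStar (n : ℤ) (hn : n ≠ 0) (S : MayaDiagram) :
    (Function.support fun k : ℤ =>
      psi (k - n) (psiStar k (Finsupp.single S (1 : ℚ)))).Finite := by
  refine (((S.2.1.union ((S.2.2.image (fun s => s + n)).union
    ((Set.finite_Ico (0 : ℤ) n).union (Set.finite_Ico n 0))))).subset ?_)
  intro k hk
  have h1 : k ∈ S.1 := by
    by_contra h
    exact hk (by simp [psiStar, h])
  have h2 : k - n ∉ S.1 := by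
    intro h
    apply hk
    have h3 : k - n ∈ (S.erase k).1 := ⟨h, by simp [hn]⟩
    simp [psiStar, h1, psi, h3]
  by_cases h0 : 0 ≤ k
  · exact Or.inl ⟨h0, h1⟩
  · by_cases h3 : k - n < 0
    · exact Or.inr (Or.inl ⟨k - n, ⟨h3, h2⟩, by simp⟩)
    · refine Or.inr (Or.inr (Or.inr ⟨?_, ?_⟩)) <;> omega

/-- The Heisenberg operator `α_n = ∑_k ψ_{k-n} ψ_k^*`, for `n ≠ 0`. -/
def alpha (n : ℤ) : Module.End ℚ Wedge :=
  Finsupp.linearCombination ℚ fun S : MayaDiagram =>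
    ∑ᶠ k : ℤ, psi (k - n) (psiStar k (Finsupp.single S (1 : ℚ)))

/-- The operator `F_m = ∑_k k ^ m :ψ_k ψ_k^*:` over half-integers `k`, which is diagonal. For
`m = r + 1`, the operator `F_{r+1} / (r+1)` is multiplication by the completed `(r+1)`-cycle. -/
def completedCycle (m : ℕ) : Module.End ℚ Wedge :=
  Finsupp.linearCombination ℚ fun S : MayaDiagram => Finsupp.single S (S.powerSum m)

/-- The sandwich `⟨A⟩` of an operator between two vacuum states. -/
def vacExp (A : Module.End ℚ Wedge) : ℚ :=
  A (Finsupp.single MayaDiagram.vacuum 1) MayaDiagram.vacuum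

/-! ### Hurwitz numbers -/

open scoped Nat in
/-- The disconnected `r`-spin `q`-orbifold Hurwitz number of the tuple `μ`, with `b` completed
`(r+1)`-cycles (the genus `g` being determined by `q r b = (2g - 2 + ℓ(μ)) q + |μ|`):
`⟨ α_q^{|μ|/q} / (q^{|μ|/q} (|μ|/q)!) · F_{r+1}^b / (r+1)^b · ∏ α_{-μ_i} / μ_i ⟩`.
It is zero if `q` does not divide `|μ|`. -/
def hurwitzDisc (q r b : ℕ) (μ : List ℕ) : ℚ :=
  if q ∣ μ.sum then
    vacExp
      (((q : ℚ) ^ (μ.sum / q) * ((μ.sum / q)! : ℚ))⁻¹ • alpha q ^ (μ.sum / q) *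
        (((r : ℚ) + 1) ^ b)⁻¹ • completedCycle (r + 1) ^ b *
        (μ.map fun m : ℕ => (m : ℚ)⁻¹ • alpha (-(m : ℤ))).prod)
  else 0

open scoped Nat in
/-- The connected `r`-spin `q`-orbifold Hurwitz number of `μ = (μ_1, …, μ_n)`, `n ≥ 1`, with `b`
completed `(r+1)`-cycles, obtained from the disconnected ones by inclusion-exclusion: the numbers
`h / b!` are the coefficients of the logarithm of the disconnected generating series
(the `b` completed cycles are distributed over the blocks of a set partition). -/
def hurwitzConn (q r b : ℕ) {n : ℕ} (μ : Fin n → ℕ) : ℚ :=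
  (b ! : ℚ) * ∑ P : Finpartition (Finset.univ : Finset (Fin n)),
    (-1 : ℚ) ^ (P.parts.card - 1) * ((P.parts.card - 1)! : ℚ) *
      ∑ c ∈ P.parts.piAntidiag b,
        ∏ B ∈ P.parts, hurwitzDisc q r (c B) ((B.sort (· ≤ ·)).map μ) / ((c B)! : ℚ)

/-- The integer `(2g - 2 + n) q + d`, which has to equal `q r b`, where `b` is the number of
completed cycles in genus `g`, with `n` parts of total size `d`. -/
def ramification (q : ℕ) (g n d : ℕ) : ℤ := (2 * (g : ℤ) - 2 + n) * q + d

open scoped Nat in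
/-- The correlator `H_{g,n}(x_1, …, x_n) = ∑_{μ_1, …, μ_n ≥ 1} h_{g;μ} / b! · ∏ x_i ^ μ_i`, with
`b = ((2g - 2 + n) q + |μ|) / (q r)`; only those `μ` contribute for which `b` is a nonnegative
integer. -/
def correlator (q r g n : ℕ) : MvPowerSeries (Fin n) ℚ := fun μ =>
  let a : ℤ := ramification q g n (∑ i, μ i)
  let b : ℕ := (a / ((q : ℤ) * r)).toNat
  if (∀ i, 0 < μ i) ∧ 0 ≤ a ∧ ((q : ℤ) * r) ∣ a then hurwitzConn q r b μ / (b ! : ℚ) else 0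

/-! ### Formal power series -/

/-- The operator `D_{x_i} = x_i ∂/∂x_i`. -/
def D {n : ℕ} (i : Fin n) (f : MvPowerSeries (Fin n) ℚ) : MvPowerSeries (Fin n) ℚ :=
  MvPowerSeries.X i * MvPowerSeries.pderiv ℚ i f

/-- The specialization `f(x, …, x)` of `f(x_1, …, x_n)`. -/
def diagonal {n : ℕ} (f : MvPowerSeries (Fin n) ℚ) : PowerSeries ℚ :=
  MvPowerSeries.subst (fun _ => (PowerSeries.X : PowerSeries ℚ)) f

/-- The series `f(x_i)` in two variables, given `f(x)` in one variable. -/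
def inVar (i : Fin 2) (f : PowerSeries ℚ) : MvPowerSeries (Fin 2) ℚ :=
  PowerSeries.subst (MvPowerSeries.X i : MvPowerSeries (Fin 2) ℚ) f

/-- The function `x(z) = z exp(-z^{qr})`, as a power series in `z`. -/
def xOfZ (q r : ℕ) : PowerSeries ℚ :=
  PowerSeries.X * (PowerSeries.exp ℚ).subst (-PowerSeries.X ^ (q * r) : PowerSeries ℚ)

theorem constantCoeff_xOfZ (q r : ℕ) : PowerSeries.constantCoeff (xOfZ q r) = 0 := by
  simp [xOfZ]

theorem hasSubst_neg_pow (q r : ℕ) [NeZero q] [NeZero r] {f : PowerSeries ℚ}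
    (hf : PowerSeries.constantCoeff f = 0) :
    PowerSeries.HasSubst (-f ^ (q * r) : PowerSeries ℚ) := by
  apply PowerSeries.HasSubst.of_constantCoeff_zero'
  simp [hf, NeZero.ne q, NeZero.ne r]

theorem isUnit_coeff_one_xOfZ (q r : ℕ) [NeZero q] [NeZero r] :
    IsUnit (PowerSeries.coeff 1 (xOfZ q r)) := by
  have h : PowerSeries.coeff 1 (xOfZ q r) = 1 := by
    rw [xOfZ, show (1 : ℕ) = 0 + 1 from rfl, PowerSeries.coeff_succ_X_mul,
      PowerSeries.coeff_subst' (hasSubst_neg_pow q r (by simp)), finsum_eq_single _ 0]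
    · simp
    · intro d hd
      simp [hd, NeZero.ne q, NeZero.ne r]
  rw [h]
  exact isUnit_one

/-- The coordinate `z = z(x)`: the compositional inverse at `0` of `x(z) = z exp(-z^{qr})`. -/
def zSeries (q r : ℕ) [NeZero q] [NeZero r] : PowerSeries ℚ :=
  PowerSeries.substInvOfIsUnit (xOfZ q r) (isUnit_coeff_one_xOfZ q r)

theorem constantCoeff_zSeries (q r : ℕ) [NeZero q] [NeZero r] :
    PowerSeries.constantCoeff (zSeries q r) = 0 := by
  simp [zSeries]

/-- The defining equation `z exp(-z^{qr}) = x` of the series `z = z(x)`. -/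
theorem zSeries_spec (q r : ℕ) [NeZero q] [NeZero r] :
    zSeries q r * (PowerSeries.exp ℚ).subst (-zSeries q r ^ (q * r) : PowerSeries ℚ)
      = PowerSeries.X := by
  have hz : PowerSeries.HasSubst (zSeries q r) :=
    PowerSeries.HasSubst.of_constantCoeff_zero' (constantCoeff_zSeries q r)
  have h : (xOfZ q r).subst (zSeries q r) = PowerSeries.X :=
    PowerSeries.subst_substInvOfIsUnit_right _ (constantCoeff_xOfZ q r) _
  have h2 : PowerSeries.subst (zSeries q r) (-PowerSeries.X ^ (q * r) : PowerSeries ℚ)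
      = -zSeries q r ^ (q * r) := by
    rw [← PowerSeries.coe_substAlgHom hz, map_neg, map_pow, PowerSeries.coe_substAlgHom hz,
      PowerSeries.subst_X hz]
  rw [xOfZ, PowerSeries.subst_mul hz, PowerSeries.subst_X hz,
    PowerSeries.subst_comp_subst_apply (hasSubst_neg_pow q r (by simp)) hz, h2] at h
  exact h

/-- The function `y(x) = D_x H_{0,1}(x)`. -/
def ySeries (q r : ℕ) : PowerSeries ℚ := diagonal (D 0 (correlator q r 0 1))

/-- The coordinate `t`, given by `1 / t = y ^ r - 1 / (q r)`, as a power series in `x`. -/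
def tSeries (q r : ℕ) : PowerSeries ℚ :=
  (ySeries q r ^ r - PowerSeries.C (1 / ((q : ℚ) * r)))⁻¹

/-- The series `y ^ r - 1 / (q r)` is invertible, so that `t` really is its inverse. -/
theorem tSeries_mul (q r : ℕ) [NeZero q] [NeZero r] :
    tSeries q r * (ySeries q r ^ r - PowerSeries.C (1 / ((q : ℚ) * r))) = 1 := by
  apply PowerSeries.inv_mul_cancel
  have hH : MvPowerSeries.HasSubst (fun _ : Fin 1 => (PowerSeries.X : PowerSeries ℚ)) :=
    MvPowerSeries.hasSubst_of_constantCoeff_zero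
      (fun _ => by exact PowerSeries.constantCoeff_X)
  have h0 : PowerSeries.constantCoeff (ySeries q r) = 0 := by
    rw [ySeries, diagonal, D, ← MvPowerSeries.coe_substAlgHom hH, map_mul,
      MvPowerSeries.coe_substAlgHom hH, MvPowerSeries.subst_X hH]
    simp
  simp [h0, NeZero.ne]

/-- `W_{0,2}(x_1, x_2) = D_{x_1} D_{x_2} H_{0,2}(x_1, x_2)`. -/
def W02 (q r : ℕ) : MvPowerSeries (Fin 2) ℚ := D 0 (D 1 (correlator q r 0 2))

/-- The embedding of `ℚ⟦x_1, x_2⟧` into its field of fractions. -/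
def toFrac : MvPowerSeries (Fin 2) ℚ →+* FractionRing (MvPowerSeries (Fin 2) ℚ) :=
  algebraMap _ _

end

end SpinHurwitz

namespace SpinHurwitz

/-! ### Maya diagrams: inserting and removing a half-integer. -/

namespace MayaDiagram

/-! Fermionic side. Both F_{r+1} and α_q kill the vacuum, so an expectation is computed by commuting
them to the right through the α_{-μ_i}, viewed as bilinear sums ∑ f(k) :ψ_{k+s} ψ_k^*: with s = μ_i
and f = 1. A commutator with F_{r+1} multiplies f by (k+s)^{r+1} - k^{r+1}
(`completedCycle_mul_bilinear`); a commutator with α_q replaces f by its backward difference of step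
q, lowers s by q, and produces a scalar when s = q (`alpha_mul_bilinear`). After b_i completed
cycles f is a polynomial of degree at most r b_i, with coefficient ((r+1) μ_i)^{b_i} in that degree,
and in genus zero the number of differences isolates exactly this coefficient. For one part there
are rb + 1 commutators, the last giving the scalar. For two parts there are rb: the products of
scalars are the disconnected contribution and cancel, and in the rest each operator must be
differenced exactly r b_i times, leaving ⟨α_s α_{-s}⟩ = s. Hence h°/b! is the sum over b₁ + b₂ = b
of max(ν - q r b₂, 0) μ^{b₁} ν^{b₂} / (b₁! b₂! μ ν).

Power series side. Put N = qr. Lagrange inversion gives n^k/k!, for n = i + N k, as the coefficient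
of x^n in z^i / (1 - N z^N) (`coeff_zSeries_pow_mul`), whence y = z^q. For H_{0,2}, apply D_{x_1} +
D_{x_2}, which multiplies coefficients by the total degree. The sum above then telescopes to a
single product (`sum_telescope`), while the derivative of the logarithm is a finite sum of products
of Lagrange series in z₁ and z₂ (`euler_logDivDiff`), of which at most one contributes to a given
coefficient with positive exponents. The coefficients with a vanishing exponent account for -y₁^r -
y₂^r.

The formula for W_{0,2} follows by differentiating the logarithm. On the diagonal, the divided
difference Q = (z₁ - z₂)/(x₁ - x₂) and its derivatives become combinations of Euler derivatives of
z, and all of these are z times polynomials in 1/(1 - N z^N) = -t/N. -/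

theorem mem_insert {s k : ℤ} {S : MayaDiagram} : s ∈ (S.insert k).1 ↔ s = k ∨ s ∈ S.1 := Iff.rfl

theorem mem_erase {s k : ℤ} {S : MayaDiagram} : s ∈ (S.erase k).1 ↔ s ∈ S.1 ∧ s ≠ k := Iff.rfl

theorem mem_vacuum {s : ℤ} : s ∈ vacuum.1 ↔ s < 0 := Iff.rfl

theorem ext_mem {S T : MayaDiagram} (h : ∀ s, s ∈ S.1 ↔ s ∈ T.1) : S = T :=
  Subtype.ext (Set.ext h)

theorem above_insert {k l : ℤ} {S : MayaDiagram} (hl : l ∉ S.1) :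
    (S.insert l).above k = S.above k + if k < l then 1 else 0 := by
  unfold above
  split_ifs with h
  · have : {s : ℤ | s ∈ (S.insert l).1 ∧ k < s}
        = Insert.insert l {s : ℤ | s ∈ S.1 ∧ k < s} := by
      ext s
      simp only [mem_insert, Set.mem_ofPred_eq, Set.mem_insert_iff]
      grind
    rw [this, Set.ncard_insert_of_notMem (by simp [hl]) (finite_above k S)]
  · rw [add_zero]
    congr 1
    ext s
    simp only [mem_insert, Set.mem_ofPred_eq]
    grind

theorem insert_erase {k : ℤ} {S : MayaDiagram} (h : k ∈ S.1) : (S.erase k).insert k = S :=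
  ext_mem fun s => by simp only [mem_insert, mem_erase]; grind

theorem erase_insert {k : ℤ} {S : MayaDiagram} (h : k ∉ S.1) : (S.insert k).erase k = S :=
  ext_mem fun s => by simp only [mem_insert, mem_erase]; grind

theorem above_erase {k l : ℤ} {S : MayaDiagram} (hl : l ∈ S.1) :
    S.above k = (S.erase l).above k + if k < l then 1 else 0 := by
  conv_lhs => rw [← insert_erase hl]
  exact above_insert (by simp [mem_erase])

/-- A nonnegative `k` adds a term to the first sum; a negative `k` fills a hole and so drops a term
from the subtracted sum. The effect is the same. -/
theorem powerSum_insert {m : ℕ} {k : ℤ} {S : MayaDiagram} (hk : k ∉ S.1) :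
    (S.insert k).powerSum m = S.powerSum m + ((k : ℚ) + 1 / 2) ^ m := by
  unfold powerSum
  rcases le_or_gt 0 k with h | h
  · have h1 : (S.insert k).2.1.toFinset = Insert.insert k S.2.1.toFinset := by
      ext s
      simp only [Set.Finite.mem_toFinset, Set.mem_ofPred_eq, Finset.mem_insert, mem_insert]
      grind
    have h2 : (S.insert k).2.2.toFinset = S.2.2.toFinset := by
      ext s
      simp only [Set.Finite.mem_toFinset, Set.mem_ofPred_eq, mem_insert]
      grind
    rw [h1, h2, Finset.sum_insert (by simp [hk])]
    ring
  · have h1 : (S.insert k).2.1.toFinset = S.2.1.toFinset := by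
      ext s
      simp only [Set.Finite.mem_toFinset, Set.mem_ofPred_eq, mem_insert]
      grind
    have h2 : S.2.2.toFinset = Insert.insert k (S.insert k).2.2.toFinset := by
      ext s
      simp only [Set.Finite.mem_toFinset, Set.mem_ofPred_eq, Finset.mem_insert, mem_insert]
      grind
    rw [h1, h2, Finset.sum_insert (by simp [mem_insert])]
    ring

theorem powerSum_erase {m : ℕ} {k : ℤ} {S : MayaDiagram} (hk : k ∈ S.1) :
    S.powerSum m = (S.erase k).powerSum m + ((k : ℚ) + 1 / 2) ^ m := by
  conv_lhs => rw [← insert_erase hk]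
  exact powerSum_insert (by simp [mem_erase])

theorem powerSum_vacuum (m : ℕ) : vacuum.powerSum m = 0 := by
  unfold powerSum
  rw [show vacuum.2.1.toFinset = ∅ by ext s; simp [mem_vacuum],
    show vacuum.2.2.toFinset = ∅ by ext s; simp [mem_vacuum]]
  simp

end MayaDiagram

open MayaDiagram

noncomputable section

/-! ### Fermionic operators -/

open Classical in
theorem psi_single (k : ℤ) (S : MayaDiagram) (c : ℚ) :
    psi k (Finsupp.single S c)
      = if k ∈ S.1 then 0 else Finsupp.single (S.insert k) (c * (-1 : ℚ) ^ S.above k) := by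
  unfold psi
  rw [Finsupp.linearCombination_single]
  split_ifs <;> simp

open Classical in
theorem psiStar_single (k : ℤ) (S : MayaDiagram) (c : ℚ) :
    psiStar k (Finsupp.single S c)
      = if k ∈ S.1 then Finsupp.single (S.erase k) (c * (-1 : ℚ) ^ S.above k) else 0 := by
  unfold psiStar
  rw [Finsupp.linearCombination_single]
  split_ifs <;> simp

theorem End_ext {A B : Module.End ℚ Wedge}
    (h : ∀ S, A (Finsupp.single S 1) = B (Finsupp.single S 1)) : A = B :=
  Finsupp.lhom_ext' fun S => LinearMap.ext_ring (h S)

/-- Inserting the larger index raises the count above the smaller one by one and not conversely, so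
exactly one of the two orders acquires an extra sign. -/
theorem psi_mul_psi (a b : ℤ) : psi a * psi b = -(psi b * psi a) := by
  classical
  refine End_ext fun S => ?_
  simp only [Module.End.mul_apply, LinearMap.neg_apply]
  rcases eq_or_ne a b with rfl | hab
  · by_cases h : a ∈ S.1 <;> simp [psi_single, h, mem_insert]
  by_cases ha : a ∈ S.1 <;> by_cases hb : b ∈ S.1 <;>
    simp [psi_single, ha, hb, mem_insert, hab, hab.symm, -Finsupp.single_mul]
  rw [above_insert hb, above_insert ha, ← Finsupp.single_neg,
    show (S.insert b).insert a = (S.insert a).insert b from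
      ext_mem fun s => by simp only [mem_insert]; tauto]
  congr 1
  rcases lt_or_gt_of_ne hab with h | h <;> simp [h, h.not_gt, pow_succ] <;> ring

theorem psiStar_mul_psiStar (a b : ℤ) : psiStar a * psiStar b = -(psiStar b * psiStar a) := by
  classical
  refine End_ext fun S => ?_
  simp only [Module.End.mul_apply, LinearMap.neg_apply]
  rcases eq_or_ne a b with rfl | hab
  · by_cases h : a ∈ S.1 <;> simp [psiStar_single, h, mem_erase]
  by_cases ha : a ∈ S.1 <;> by_cases hb : b ∈ S.1 <;>
    simp [psiStar_single, ha, hb, mem_erase, hab, hab.symm, -Finsupp.single_mul]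
  rw [above_erase (k := b) ha, above_erase (k := a) hb, ← Finsupp.single_neg,
    show (S.erase b).erase a = (S.erase a).erase b from
      ext_mem fun s => by simp only [mem_erase]; tauto]
  congr 1
  rcases lt_or_gt_of_ne hab with h | h <;> simp [h, h.not_gt, pow_succ] <;> ring

theorem psi_mul_psiStar (a b : ℤ) :
    psiStar a * psi b = (if a = b then 1 else 0) - psi b * psiStar a := by
  classical
  refine End_ext fun S => ?_
  rcases eq_or_ne a b with rfl | hab
  · by_cases h : a ∈ S.1
    · have h2 : (-1 : ℚ) ^ S.above a * (-1 : ℚ) ^ (S.erase a).above a = 1 := by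
        rw [above_erase h, ← pow_add]; simp
      simp [psiStar_single, psi_single, h, mem_erase, insert_erase h, h2]
    · have h2 : (-1 : ℚ) ^ S.above a * (-1 : ℚ) ^ (S.insert a).above a = 1 := by
        rw [above_insert h, ← pow_add]; simp
      simp [psiStar_single, psi_single, h, mem_insert, erase_insert h, h2]
  · by_cases ha : a ∈ S.1 <;> by_cases hb : b ∈ S.1 <;>
      simp [psi_single, psiStar_single, ha, hb, mem_insert, mem_erase, hab, hab.symm,
        -Finsupp.single_mul]
    rw [above_erase (k := b) ha, above_insert (k := a) hb, ← Finsupp.single_neg,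
      show (S.insert b).erase a = (S.erase a).insert b from
        ext_mem fun s => by simp only [mem_insert, mem_erase]; grind]
    congr 1
    rcases lt_or_gt_of_ne hab with h | h <;> simp [h, h.not_gt, pow_succ] <;> ring

/-- The normally ordered product `:ψ_a ψ_b^*:`. -/
def normalOrd (a b : ℤ) : Module.End ℚ Wedge :=
  psi a * psiStar b - if a = b ∧ b < 0 then 1 else 0

/-- For `s = 0` the operator measures occupation minus vacuum occupation, which vanishes wherever
the diagram agrees with the vacuum. For other shifts a particle must jump to an empty place. -/
theorem finite_support_normalOrd (s : ℤ) (v : Wedge) :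
    (Function.support fun k : ℤ => normalOrd (k + s) k v).Finite := by
  classical
  induction v using Finsupp.induction_linear with
  | zero => simp
  | add v w hv hw =>
    refine (hv.union hw).subset fun k hk => ?_
    by_contra h
    simp only [Set.mem_union, Function.mem_support, not_or, not_not] at h
    exact hk (by simp [h.1, h.2])
  | single S c =>
    rw [← mul_one c, ← smul_eq_mul, ← Finsupp.smul_single]
    suffices h : (Function.support fun k : ℤ =>
        normalOrd (k + s) k (Finsupp.single S 1)).Finite from
      h.subset fun k hk h0 => hk (by
        have h0' : normalOrd (k + s) k (Finsupp.single S 1) = 0 := h0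
        simp only [map_smul, h0', smul_zero])
    rcases eq_or_ne s 0 with rfl | hs
    · refine (S.2.1.union S.2.2).subset fun k hk => ?_
      by_contra h
      simp only [Set.mem_union, Set.mem_ofPred_eq, not_or, not_and, not_not] at h
      refine hk ?_
      have key : psi k (psiStar k (Finsupp.single S 1))
          = if k ∈ S.1 then Finsupp.single S (1 : ℚ) else 0 := by
        split_ifs with hkS
        · have h2 : (-1 : ℚ) ^ S.above k * (-1 : ℚ) ^ (S.erase k).above k = 1 := by
            rw [above_erase hkS, ← pow_add]; simp
          simp [psiStar_single, psi_single, hkS, mem_erase, insert_erase hkS, h2]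
        · simp [psiStar_single, hkS]
      have hn : normalOrd k k (Finsupp.single S 1)
          = psi k (psiStar k (Finsupp.single S 1))
            - if k < 0 then Finsupp.single S (1 : ℚ) else 0 := by
        unfold normalOrd
        split_ifs <;> simp_all
      simp only [add_zero]
      rw [hn, key]
      rcases le_or_gt 0 k with hk0 | hk0
      · rw [if_neg (h.1 hk0), if_neg hk0.not_gt, sub_zero]
      · rw [if_pos (h.2 hk0), if_pos hk0, sub_self]
    · have := finite_support_psi_psiStar (-s) (by simpa using hs) S
      simpa [normalOrd, hs] using this

theorem finite_support_smul_normalOrd (f : ℤ → ℚ) (s : ℤ) (v : Wedge) :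
    (Function.support fun k : ℤ => f k • normalOrd (k + s) k v).Finite :=
  (finite_support_normalOrd s v).subset fun k hk h => hk (by
    have h' : normalOrd (k + s) k v = 0 := h
    simp only [h', smul_zero])

/-- The operator `∑_k f(k) :ψ_{k+s} ψ_k^*:`. -/
def bilinear (f : ℤ → ℚ) (s : ℤ) : Module.End ℚ Wedge where
  toFun v := ∑ᶠ k : ℤ, f k • normalOrd (k + s) k v
  map_add' v w := by
    simp only [map_add, smul_add]
    exact finsum_add_distrib (finite_support_smul_normalOrd f s v)
      (finite_support_smul_normalOrd f s w)
  map_smul' c v := by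
    simp only [map_smul, RingHom.id_apply]
    rw [smul_finsum' c (finite_support_smul_normalOrd f s v)]
    exact finsum_congr fun k => smul_comm _ _ _

theorem bilinear_apply (f : ℤ → ℚ) (s : ℤ) (v : Wedge) :
    bilinear f s v = ∑ᶠ k : ℤ, f k • normalOrd (k + s) k v := rfl

theorem normalOrd_of_ne {a b : ℤ} (h : a ≠ b) : normalOrd a b = psi a * psiStar b := by
  simp [normalOrd, h]

theorem alpha_eq_bilinear {n : ℤ} (hn : n ≠ 0) : alpha n = bilinear (fun _ => 1) (-n) := by
  refine End_ext fun S => ?_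
  rw [bilinear_apply, alpha, Finsupp.linearCombination_single, one_smul]
  refine finsum_congr fun k => ?_
  rw [normalOrd_of_ne (by simpa using hn), one_smul]
  rfl

theorem bilinear_zero (s : ℤ) : bilinear (fun _ => 0) s = 0 :=
  LinearMap.ext fun v => by simp [bilinear_apply]

theorem bilinear_const {s : ℤ} (hs : s ≠ 0) (c : ℚ) :
    bilinear (fun _ => c) s = c • alpha (-s) := by
  refine LinearMap.ext fun v => ?_
  rw [alpha_eq_bilinear (by simpa using hs), LinearMap.smul_apply, bilinear_apply, bilinear_apply,
    neg_neg, smul_finsum' c (finite_support_smul_normalOrd _ s v)]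
  simp

/-! ### Commutation relations -/

theorem alpha_apply {n : ℤ} (hn : n ≠ 0) (v : Wedge) :
    alpha n v = ∑ᶠ k : ℤ, psi (k - n) (psiStar k v) := by
  rw [alpha_eq_bilinear hn, bilinear_apply]
  refine finsum_congr fun k => ?_
  rw [normalOrd_of_ne (by simpa using hn), one_smul]
  rfl

theorem finite_support_alpha {n : ℤ} (hn : n ≠ 0) (v : Wedge) :
    (Function.support fun k : ℤ => psi (k - n) (psiStar k v)).Finite := by
  have := finite_support_normalOrd (-n) v
  simpa [normalOrd, hn, ← sub_eq_add_neg] using this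

theorem map_finsum_of_finite (A : Module.End ℚ Wedge) {f : ℤ → Wedge}
    (hf : (Function.support f).Finite) : A (∑ᶠ k, f k) = ∑ᶠ k, A (f k) :=
  A.toAddMonoidHom.map_finsum hf

theorem finite_support_map (A : Module.End ℚ Wedge) {f : ℤ → Wedge}
    (hf : (Function.support f).Finite) : (Function.support fun k => A (f k)).Finite :=
  hf.subset fun k hk h => hk (by
    have h' : f k = 0 := h
    simp only [h', map_zero])

/-- Moving ψ_l to the left past ψ_{k-n} ψ_k^* leaves an anticommutator only in the summand `k = l`.
-/
theorem alpha_mul_psi {n : ℤ} (hn : n ≠ 0) (l : ℤ) :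
    alpha n * psi l = psi (l - n) + psi l * alpha n := by
  refine LinearMap.ext fun v => ?_
  simp only [Module.End.mul_apply, LinearMap.add_apply]
  rw [alpha_apply hn, alpha_apply hn, map_finsum_of_finite _ (finite_support_alpha hn v)]
  have h : ∀ k, psi (k - n) (psiStar k (psi l v))
      = (if k = l then psi (k - n) v else 0) + psi l (psi (k - n) (psiStar k v)) := by
    intro k
    have h1 := LinearMap.congr_fun (psi_mul_psiStar k l) v
    have h2 := LinearMap.congr_fun (psi_mul_psi (k - n) l) (psiStar k v)
    simp only [Module.End.mul_apply, LinearMap.sub_apply, LinearMap.neg_apply] at h1 h2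
    rw [h1, map_sub, h2]
    split_ifs <;> simp
  rw [finsum_congr h, finsum_add_distrib _ (finite_support_map _ (finite_support_alpha hn v)),
    finsum_eq_single _ l (fun k hk => by simp [hk])]
  · simp
  · refine (Set.finite_singleton l).subset fun k hk => ?_
    by_contra h
    exact hk (by simp at h; simp [h])

theorem alpha_mul_psiStar {n : ℤ} (hn : n ≠ 0) (l : ℤ) :
    alpha n * psiStar l = -psiStar (l + n) + psiStar l * alpha n := by
  refine LinearMap.ext fun v => ?_
  simp only [Module.End.mul_apply, LinearMap.add_apply]
  rw [alpha_apply hn, alpha_apply hn, map_finsum_of_finite _ (finite_support_alpha hn v)]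
  have h : ∀ k, psi (k - n) (psiStar k (psiStar l v))
      = (if k = l + n then -psiStar k v else 0) + psiStar l (psi (k - n) (psiStar k v)) := by
    intro k
    have h1 := LinearMap.congr_fun (psi_mul_psiStar l (k - n)) (psiStar k v)
    have h2 := LinearMap.congr_fun (psiStar_mul_psiStar k l) v
    simp only [Module.End.mul_apply, LinearMap.sub_apply, LinearMap.neg_apply] at h1 h2
    rw [h1, h2, map_neg]
    by_cases hk : k = l + n
    · rw [if_pos (show l = k - n by omega), if_pos hk, Module.End.one_apply]
      abel
    · have : l ≠ k - n := fun h => hk (by omega)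
      simp [hk, this]
  rw [finsum_congr h, finsum_add_distrib _ (finite_support_map _ (finite_support_alpha hn v)),
    finsum_eq_single _ (l + n) (fun k hk => by simp [hk])]
  · simp
  · refine (Set.finite_singleton (l + n)).subset fun k hk => ?_
    by_contra h
    exact hk (by simp at h; simp [h])

/-- The backward difference `f(k) - f(k - n)`. -/
def backwardDiff (n : ℤ) (f : ℤ → ℚ) : ℤ → ℚ := fun k => f k - f (k - n)

/-- When `s = n` the two commutator terms are diagonal, at `k` and at `k + n`, and their vacuum
subtractions differ exactly for `-n ≤ k < 0`. This is the origin of the central term. -/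
theorem alpha_mul_normalOrd {n : ℤ} (hn : 0 < n) (s k : ℤ) :
    alpha n * normalOrd (k + s) k = normalOrd (k + s) k * alpha n
      + normalOrd (k + (s - n)) k - normalOrd (k + n + (s - n)) (k + n)
      + if s = n ∧ k ∈ Finset.Ico (-n) 0 then 1 else 0 := by
  have e : (if k + (s - n) = k ∧ k < 0 then (1 : Module.End ℚ Wedge) else 0)
      - (if k + n + (s - n) = k + n ∧ k + n < 0 then 1 else 0)
      = if s = n ∧ k ∈ Finset.Ico (-n) 0 then 1 else 0 := by
    simp only [Finset.mem_Ico]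
    by_cases h : s = n
    · subst h
      by_cases h1 : k < 0 <;> by_cases h2 : k + s < 0
      · rw [if_pos (by omega), if_pos (by omega), if_neg (by omega), sub_self]
      · rw [if_pos (by omega), if_neg (by omega), if_pos (by omega), sub_zero]
      · omega
      · rw [if_neg (by omega), if_neg (by omega), if_neg (by omega), sub_zero]
    · rw [if_neg (by omega), if_neg (by omega), if_neg (by omega), sub_zero]
  have hneg (A B : Module.End ℚ Wedge) : A * -B = -(A * B) := mul_neg A B
  have h1 : alpha n * (psi (k + s) * psiStar k) = psi (k + s) * psiStar k * alpha n
      + psi (k + (s - n)) * psiStar k - psi (k + n + (s - n)) * psiStar (k + n) := by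
    rw [← mul_assoc, alpha_mul_psi hn.ne', add_mul, mul_assoc (psi _), alpha_mul_psiStar hn.ne',
      show k + s - n = k + (s - n) by ring, show k + n + (s - n) = k + s by ring, mul_add,
      hneg, mul_assoc]
    abel
  rw [← e]
  unfold normalOrd
  rw [mul_sub, h1]
  have h2 : alpha n * (if k + s = k ∧ k < 0 then (1 : Module.End ℚ Wedge) else 0)
      = (if k + s = k ∧ k < 0 then (1 : Module.End ℚ Wedge) else 0) * alpha n := by
    split_ifs <;> simp
  rw [h2, sub_mul]
  abel

theorem alpha_mul_bilinear {n : ℤ} (hn : 0 < n) (f : ℤ → ℚ) (s : ℤ) :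
    alpha n * bilinear f s = bilinear f s * alpha n + bilinear (backwardDiff n f) (s - n)
      + (if s = n then ∑ k ∈ Finset.Ico (-n) 0, f k else 0) • (1 : Module.End ℚ Wedge) := by
  refine LinearMap.ext fun v => ?_
  simp only [Module.End.mul_apply, LinearMap.add_apply, LinearMap.smul_apply, Module.End.one_apply]
  set c : ℤ → Wedge := fun k => (if s = n ∧ k ∈ Finset.Ico (-n) 0 then f k else 0) • v with hc
  have hcfin : (Function.support c).Finite := by
    refine (Finset.finite_toSet (Finset.Ico (-n) 0)).subset fun k hk => ?_
    by_contra h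
    exact hk (by
      have h' : k ∉ Finset.Ico (-n) 0 := h
      simp only [hc, h', and_false, if_false, zero_smul])
  have hcsum : ∑ᶠ k, c k = (if s = n then ∑ k ∈ Finset.Ico (-n) 0, f k else 0) • v := by
    rw [finsum_eq_sum_of_support_subset (s := Finset.Ico (-n) 0)]
    · split_ifs with h
      · rw [Finset.sum_smul]
        exact Finset.sum_congr rfl fun k hk => by simp only [hc, h, hk, and_self, if_true]
      · rw [zero_smul]
        exact Finset.sum_eq_zero fun k _ => by simp only [hc, h, false_and, if_false, zero_smul]
    · intro k hk
      by_contra h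
      exact hk (by
        have h' : k ∉ Finset.Ico (-n) 0 := h
        simp only [hc, h', and_false, if_false, zero_smul])
  -- Reindexing by `k + n` moves the shift onto the coefficient, which turns the difference of the
  -- two sums into a backward difference of `f`.
  have hshift : ∑ᶠ k, f k • normalOrd (k + n + (s - n)) (k + n) v
      = ∑ᶠ k, f (k - n) • normalOrd (k + (s - n)) k v := by
    rw [← finsum_comp_equiv (Equiv.addRight n) (f := fun k => f (k - n) • _)]
    exact finsum_congr fun k => by simp
  have hshiftfin : (Function.support fun k =>
      f k • normalOrd (k + n + (s - n)) (k + n) v).Finite := by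
    have := (finite_support_smul_normalOrd (fun k => f (k - n)) (s - n) v).preimage
      ((Equiv.addRight n).injective.injOn)
    refine this.subset fun k hk => ?_
    simpa using hk
  have hd : bilinear (backwardDiff n f) (s - n) v
      = ∑ᶠ k, f k • normalOrd (k + (s - n)) k v
        - ∑ᶠ k, f (k - n) • normalOrd (k + (s - n)) k v := by
    rw [bilinear_apply, ← finsum_sub_distrib (finite_support_smul_normalOrd _ _ v)
      (finite_support_smul_normalOrd _ _ v)]
    exact finsum_congr fun k => sub_smul _ _ _
  rw [hd, ← hcsum, ← hshift, bilinear_apply, bilinear_apply,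
    map_finsum_of_finite _ (finite_support_smul_normalOrd f s v), ← add_sub_assoc,
    ← finsum_add_distrib (finite_support_smul_normalOrd _ _ _)
      (finite_support_smul_normalOrd _ _ _),
    ← finsum_sub_distrib ?_ hshiftfin, ← finsum_add_distrib ?_ hcfin]
  · refine finsum_congr fun k => ?_
    have := LinearMap.congr_fun (alpha_mul_normalOrd hn s k) v
    simp only [Module.End.mul_apply, LinearMap.add_apply, LinearMap.sub_apply] at this
    rw [map_smul, this, smul_add, smul_sub, smul_add]
    simp only [hc]
    split_ifs <;> simp
  · exact (((finite_support_smul_normalOrd f s (alpha n v)).union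
      (finite_support_smul_normalOrd f (s - n) v)).union hshiftfin).subset
        ((Function.support_sub _ _).trans (Set.union_subset_union_left _
          (Function.support_add _ _)))
  · exact ((finite_support_smul_normalOrd f s (alpha n v)).union
      (finite_support_smul_normalOrd f (s - n) v)).subset (Function.support_add _ _)

theorem completedCycle_single (m : ℕ) (S : MayaDiagram) (c : ℚ) :
    completedCycle m (Finsupp.single S c) = Finsupp.single S (c * S.powerSum m) := by
  simp [completedCycle]

theorem completedCycle_mul_psi (m : ℕ) (k : ℤ) :
    completedCycle m * psi k
      = psi k * completedCycle m + ((k : ℚ) + 1 / 2) ^ m • psi k := by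
  classical
  refine End_ext fun S => ?_
  simp only [Module.End.mul_apply, LinearMap.add_apply, LinearMap.smul_apply]
  by_cases h : k ∈ S.1
  · simp [completedCycle_single, psi_single, h]
  · simp only [completedCycle_single, psi_single, h, if_false, powerSum_insert h,
      Finsupp.smul_single, ← Finsupp.single_add]
    congr 1
    simp only [smul_eq_mul]
    ring

theorem completedCycle_mul_psiStar (m : ℕ) (k : ℤ) :
    completedCycle m * psiStar k
      = psiStar k * completedCycle m - ((k : ℚ) + 1 / 2) ^ m • psiStar k := by
  classical
  refine End_ext fun S => ?_
  simp only [Module.End.mul_apply, LinearMap.sub_apply, LinearMap.smul_apply]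
  by_cases h : k ∈ S.1
  · simp only [completedCycle_single, psiStar_single, h, if_true, powerSum_erase (m := m) h,
      Finsupp.smul_single, ← Finsupp.single_sub]
    congr 1
    simp only [smul_eq_mul]
    ring
  · simp [completedCycle_single, psiStar_single, h]

/-- The difference of `m`-th powers of the half-integers `k + s` and `k`. -/
def powerDiff (m : ℕ) (s : ℤ) : ℤ → ℚ :=
  fun k => ((k : ℚ) + 1 / 2 + s) ^ m - ((k : ℚ) + 1 / 2) ^ m

theorem completedCycle_mul_normalOrd (m : ℕ) (s k : ℤ) :
    completedCycle m * normalOrd (k + s) k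
      = normalOrd (k + s) k * completedCycle m + powerDiff m s k • normalOrd (k + s) k := by
  have hsub (a b : ℚ) (A : Module.End ℚ Wedge) : (a - b) • A = a • A - b • A := sub_smul a b A
  have h : completedCycle m * (psi (k + s) * psiStar k)
      = psi (k + s) * psiStar k * completedCycle m
        + powerDiff m s k • (psi (k + s) * psiStar k) := by
    rw [← mul_assoc, completedCycle_mul_psi, add_mul, mul_assoc (psi _),
      completedCycle_mul_psiStar, mul_sub, powerDiff, hsub, smul_mul_assoc, mul_smul_comm,
      Int.cast_add]
    rw [show (k : ℚ) + s + 1 / 2 = k + 1 / 2 + s by ring, mul_assoc]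
    abel
  unfold normalOrd
  by_cases hs : s = 0
  · have h0 : powerDiff m s k = 0 := by simp [powerDiff, hs]
    rw [mul_sub, h, h0]
    split_ifs <;> simp [sub_mul]
  · simp [hs, h]

/-- Moving a particle from `k` to `k + s` changes the eigenvalue of the diagonal operator by a
quantity depending only on `k` and `s`. -/
theorem completedCycle_mul_bilinear (m : ℕ) (f : ℤ → ℚ) (s : ℤ) :
    completedCycle m * bilinear f s
      = bilinear f s * completedCycle m + bilinear (f * powerDiff m s) s := by
  refine LinearMap.ext fun v => ?_
  simp only [Module.End.mul_apply, LinearMap.add_apply]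
  rw [bilinear_apply, bilinear_apply, bilinear_apply,
    map_finsum_of_finite _ (finite_support_smul_normalOrd f s v),
    ← finsum_add_distrib (finite_support_smul_normalOrd _ _ _)
      (finite_support_smul_normalOrd _ _ _)]
  refine finsum_congr fun k => ?_
  have := LinearMap.congr_fun (completedCycle_mul_normalOrd m s k) v
  simp only [Module.End.mul_apply, LinearMap.add_apply, LinearMap.smul_apply] at this
  rw [map_smul, this, smul_add, Pi.mul_apply, mul_smul]

/-! ### The vacuum -/

/-- The vacuum vector. -/
abbrev vac : Wedge := Finsupp.single vacuum 1

theorem vacExp_apply (A : Module.End ℚ Wedge) : vacExp A = A vac vacuum := rfl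

/-- In the vacuum every place below an occupied one is occupied, so no particle can move down; for
`s = 0` the subtraction cancels the occupation number. -/
theorem normalOrd_vac {s : ℤ} (hs : s ≤ 0) (k : ℤ) : normalOrd (k + s) k vac = 0 := by
  classical
  unfold normalOrd
  rcases hs.eq_or_lt with rfl | hs
  · by_cases hk : k < 0
    · have h2 : (-1 : ℚ) ^ vacuum.above k * (-1 : ℚ) ^ (vacuum.erase k).above k = 1 := by
        rw [above_erase (mem_vacuum.2 hk), ← pow_add]; simp
      simp [hk, psiStar_single, psi_single, mem_vacuum, mem_erase, insert_erase, h2]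
    · simp [hk, psiStar_single, mem_vacuum]
  · by_cases hk : k < 0
    · have : k + s < 0 := by omega
      simp [hs.ne, psiStar_single, psi_single, mem_vacuum, mem_erase, hk, this]
    · simp [hs.ne, hk, psiStar_single, mem_vacuum]

theorem bilinear_vac {s : ℤ} (hs : s ≤ 0) (f : ℤ → ℚ) : bilinear f s vac = 0 := by
  simp [bilinear_apply, normalOrd_vac hs]

theorem alpha_vac {n : ℤ} (hn : 0 < n) : alpha n vac = 0 := by
  rw [alpha_eq_bilinear hn.ne', bilinear_vac (by omega)]

theorem completedCycle_vac (m : ℕ) : completedCycle m vac = 0 := by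
  simp [completedCycle_single, powerSum_vacuum]

/-- For `s ≤ 0` the vacuum is killed; for `s > 0` each surviving term leaves a hole at some `k < 0`,
so it is not a multiple of the vacuum. -/
theorem vacExp_bilinear (f : ℤ → ℚ) (s : ℤ) : vacExp (bilinear f s) = 0 := by
  classical
  rw [vacExp_apply]
  rcases le_or_gt s 0 with hs | hs
  · simp [bilinear_vac hs]
  have : ∀ k, (f k • normalOrd (k + s) k vac) vacuum = 0 := by
    intro k
    rw [normalOrd_of_ne (by omega), Finsupp.smul_apply, Module.End.mul_apply, psiStar_single]
    split_ifs with hk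
    · rw [psi_single]
      split_ifs with h2
      · simp
      · rw [Finsupp.single_eq_of_ne, smul_zero]
        intro h3
        have : k ∈ ((vacuum.erase k).insert (k + s)).1 := h3 ▸ hk
        simp only [mem_insert, mem_erase] at this
        omega
    · simp
  rw [bilinear_apply]
  have h := (Finsupp.lapply (R := ℚ) (M := ℚ) vacuum).toAddMonoidHom.map_finsum
    (finite_support_smul_normalOrd f s vac)
  refine h.trans ?_
  rw [← finsum_zero (α := ℤ)]
  exact finsum_congr this

/-- With constant coefficients the backward difference is zero, so for `s > 0` only the central term
remains: `s` equal summands. For `s ≤ 0` the right factor kills the vacuum. -/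
theorem vacExp_const_mul_const (s : ℤ) (a b : ℚ) :
    vacExp (bilinear (fun _ => a) (-s) * bilinear (fun _ => b) s)
      = if 0 < s then a * b * s else 0 := by
  rw [vacExp_apply, Module.End.mul_apply]
  split_ifs with hs
  · have h := LinearMap.congr_fun (alpha_mul_bilinear hs (fun _ => b) s) vac
    simp only [Module.End.mul_apply, LinearMap.add_apply, LinearMap.smul_apply, alpha_vac hs,
      map_zero, zero_add, sub_self, bilinear_vac le_rfl, if_true, Module.End.one_apply] at h
    rw [bilinear_const (by omega), neg_neg, LinearMap.smul_apply, h]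
    have : ((s.toNat : ℕ) : ℚ) = s := by exact_mod_cast Int.toNat_of_nonneg hs.le
    simp [this]
    ring
  · rw [bilinear_vac (by omega)]
    simp

end

end SpinHurwitz

/-! ### Iterated commutators and finite differences of polynomials. -/

namespace SpinHurwitz

open Finset in
-- Here `B j` is the `j`-fold commutator of `A` with `B 0`, and this is the resulting Leibniz
-- expansion. On a vector killed by `A` only the term `p = (n, 0)` survives.
theorem pow_mul_eq_sum_of_commutator {R : Type*} [Ring R] {A : R} {B : ℕ → R}
    (h : ∀ j, A * B j = B j * A + B (j + 1)) (n : ℕ) :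
    A ^ n * B 0 = ∑ p ∈ antidiagonal n, n.choose p.1 • (B p.1 * A ^ p.2) := by
  induction n with
  | zero => simp
  | succ n ih =>
    rw [sum_antidiagonal_choose_succ_nsmul (fun i j => B i * A ^ j) n, pow_succ', mul_assoc, ih,
      mul_sum, ← sum_add_distrib]
    refine sum_congr rfl fun p hp => ?_
    rw [mul_smul_comm, ← mul_assoc, h, add_mul, smul_add, mul_assoc, ← pow_succ',
      Nat.choose_symm_of_eq_add (mem_antidiagonal.1 hp).symm]

/-! ### Backward differences of polynomials -/

/-- Along the progression `k - q * m` a backward step of size `q` is a forward unit step in `m`, up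
to sign, so the theory of `fwdDiff` on polynomials applies. -/
theorem iterate_backwardDiff_eq_fwdDiff {q : ℤ} {f : ℤ → ℚ} {k : ℤ} {R : ℚ → ℚ}
    (h : ∀ m : ℤ, f (k - q * m) = R m) (j : ℕ) (m : ℤ) :
    (backwardDiff q)^[j] f (k - q * m) = (-1) ^ j * (fwdDiff 1)^[j] R m := by
  induction j generalizing m with
  | zero => simpa using h m
  | succ j ih =>
    have e : k - q * m - q = k - q * (m + 1) := by ring
    rw [Function.iterate_succ_apply', Function.iterate_succ_apply', backwardDiff, e, ih, ih, fwdDiff]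
    push_cast
    ring

open Polynomial in
theorem iterate_backwardDiff_eval (q : ℤ) (P : ℚ[X]) (c : ℚ) {n j : ℕ} (hP : P.natDegree ≤ n)
    (hj : n ≤ j) :
    (backwardDiff q)^[j] (fun k => P.eval ((k : ℚ) + c))
      = fun _ => if j = n then P.coeff n * (q : ℚ) ^ n * n.factorial else 0 := by
  funext k
  -- The sign of the substitution contributes `(-1) ^ n` to the coefficient of degree `n`; it
  -- cancels the sign from passing to forward differences.
  set R : ℚ[X] := P.comp (C (-(q : ℚ)) * X + C ((k : ℚ) + c)) with hR
  have hf : ∀ m : ℤ, (fun k : ℤ => P.eval ((k : ℚ) + c)) (k - q * m) = R.eval (m : ℚ) := by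
    intro m
    simp only [hR, eval_comp, eval_add, eval_mul, eval_C, eval_X]
    push_cast
    congr 1
    ring
  have h0 := iterate_backwardDiff_eq_fwdDiff
    (f := fun k : ℤ => P.eval ((k : ℚ) + c)) (R := fun x => R.eval x) hf j 0
  rw [mul_zero, sub_zero] at h0
  rw [h0]
  have hdeg : R.natDegree ≤ n := by
    refine natDegree_comp_le.trans ?_
    calc P.natDegree * _ ≤ n * 1 := Nat.mul_le_mul hP natDegree_linear_le
      _ = n := mul_one n
  have hcoeff : R.coeff n = P.coeff n * (-(q : ℚ)) ^ n := by
    have h2 : ∀ i, (C (P.coeff i) * (C (-(q : ℚ)) * X + C ((k : ℚ) + c)) ^ i).coeff n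
        = if i = n then P.coeff i * (-(q : ℚ)) ^ n else if i < n then 0 else
          (C (P.coeff i) * (C (-(q : ℚ)) * X + C ((k : ℚ) + c)) ^ i).coeff n := by
      intro i
      split_ifs with h1 h2
      · subst h1
        rw [coeff_C_mul]
        congr 1
        have := coeff_pow_of_natDegree_le (p := C (-(q : ℚ)) * X + C ((k : ℚ) + c)) (m := i)
          natDegree_linear_le
        rw [mul_one] at this
        rw [this, coeff_add, coeff_C_mul, coeff_X_one, coeff_C_of_ne_zero one_ne_zero, mul_one,
          add_zero]
      · refine coeff_eq_zero_of_natDegree_lt (lt_of_le_of_lt (natDegree_C_mul_le _ _) ?_)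
        refine lt_of_le_of_lt (natDegree_pow_le_of_le i natDegree_linear_le) ?_
        omega
      · rfl
    rw [hR, comp_eq_sum_left, sum_over_range' _ (by simp) (n + 1) (by omega), finsetSum_coeff,
      Finset.sum_range_succ, Finset.sum_eq_zero, zero_add, h2, if_pos rfl]
    intro i hi
    rw [Finset.mem_range] at hi
    rw [h2, if_neg hi.ne, if_pos hi]
  split_ifs with hjn
  · subst hjn
    -- The factorial formula needs the exact degree. If the degree drops, the coefficient of degree
    -- `n` is zero and both sides vanish.
    rcases hdeg.lt_or_eq with hlt | heq
    · rw [Polynomial.fwdDiff_iter_eq_zero_of_degree_lt hlt]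
      have h3 := coeff_eq_zero_of_natDegree_lt hlt
      rw [hcoeff] at h3
      have h4 : P.coeff j * (q : ℚ) ^ j = 0 := by
        rcases mul_eq_zero.1 h3 with h | h
        · rw [h, zero_mul]
        · rw [neg_pow] at h
          rw [(mul_eq_zero.1 h).resolve_left (by simp), mul_zero]
      simp [h4]
    · have h3 := Polynomial.fwdDiff_iter_degree_eq_factorial R
      rw [leadingCoeff, heq, hcoeff] at h3
      rw [h3]
      simp only [Pi.smul_apply, smul_eq_mul, Pi.natCast_apply]
      rw [neg_pow (q : ℚ), show ((-1 : ℚ)) ^ j * (P.coeff j * ((-1) ^ j * (q : ℚ) ^ j) * (j.factorial : ℚ))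
        = ((-1) ^ j * (-1) ^ j) * (P.coeff j * (q : ℚ) ^ j * (j.factorial : ℚ)) by ring,
        ← pow_add, Even.neg_one_pow ⟨j, rfl⟩, one_mul]
  · rw [Polynomial.fwdDiff_iter_eq_zero_of_degree_lt (by omega)]
    simp

open Polynomial in
/-- Iterated backward differences of `((k + μ)^{r+1} - k^{r+1})^b`, a polynomial of degree `r b`. -/
theorem iterate_backwardDiff_powerDiff_pow (q : ℤ) (r b : ℕ) (μ : ℤ) {j : ℕ} (hj : r * b ≤ j) :
    (backwardDiff q)^[j] (powerDiff (r + 1) μ ^ b)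
      = fun _ => if j = r * b then
          (((r : ℚ) + 1) * μ) ^ b * (q : ℚ) ^ (r * b) * (r * b).factorial else 0 := by
  set P : ℚ[X] := (X + C (μ : ℚ)) ^ (r + 1) - X ^ (r + 1) with hP
  have hdeg : P.natDegree ≤ r := by
    rw [natDegree_le_iff_coeff_eq_zero]
    intro N hN
    rw [hP, coeff_sub, coeff_X_add_C_pow, coeff_X_pow]
    rcases eq_or_ne N (r + 1) with rfl | hne
    · simp
    · rw [Nat.choose_eq_zero_of_lt (by omega), if_neg hne]
      simp
  have hcoeff : P.coeff r = ((r : ℚ) + 1) * μ := by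
    rw [hP, coeff_sub, coeff_X_add_C_pow, coeff_X_pow, if_neg (by omega)]
    simp
    ring
  have hf : powerDiff (r + 1) μ ^ b = fun k : ℤ => (P ^ b).eval ((k : ℚ) + 1 / 2) := by
    funext k
    simp [powerDiff, hP]
  have h := iterate_backwardDiff_eval q (P ^ b) (1 / 2) (n := r * b)
    ((natDegree_pow_le_of_le b hdeg).trans (by rw [mul_comm])) hj
  rw [hf, h]
  rw [mul_comm r b, coeff_pow_of_natDegree_le hdeg, hcoeff]

noncomputable section

/-! ### Expectation values -/

/-- The central term of the `j`-fold commutator of `α_q` with `∑_k f(k) :ψ_{k+s} ψ_k^*:`. -/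
def centralTerm (q : ℕ) (f : ℤ → ℚ) (s : ℤ) (j : ℕ) : ℚ :=
  if 0 < j ∧ s = q * j then ∑ k ∈ Finset.Ico (-(q : ℤ)) 0, (backwardDiff q)^[j - 1] f k else 0

/-- The `j`-fold commutator of `α_q` with `∑_k f(k) :ψ_{k+s} ψ_k^*:`. -/
def alphaBracket (q : ℕ) (f : ℤ → ℚ) (s : ℤ) (j : ℕ) : Module.End ℚ Wedge :=
  bilinear ((backwardDiff q)^[j] f) (s - q * j) + centralTerm q f s j • 1

theorem alphaBracket_zero (q : ℕ) (f : ℤ → ℚ) (s : ℤ) : alphaBracket q f s 0 = bilinear f s := by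
  simp [alphaBracket, centralTerm]

/-- The scalar part commutes with α_q, so the central term of order `j + 1` is created afresh from
the bilinear part of order `j`, exactly when its shift `s - q * j` equals `q`. -/
theorem alpha_mul_alphaBracket {q : ℕ} (hq : 0 < q) (f : ℤ → ℚ) (s : ℤ) (j : ℕ) :
    alpha q * alphaBracket q f s j
      = alphaBracket q f s j * alpha q + alphaBracket q f s (j + 1) := by
  have h := alpha_mul_bilinear (n := q) (by exact_mod_cast hq) ((backwardDiff q)^[j] f) (s - q * j)
  unfold alphaBracket
  rw [mul_add, h, add_mul, mul_smul_comm, smul_mul_assoc, mul_one, one_mul,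
    Function.iterate_succ_apply', show s - (q : ℤ) * (j + 1 : ℕ) = s - q * j - q by push_cast; ring]
  have hc : centralTerm q f s (j + 1)
      = if s - (q : ℤ) * j = q then
          ∑ k ∈ Finset.Ico (-(q : ℤ)) 0, (backwardDiff q)^[j] f k else 0 := by
    unfold centralTerm
    rw [Nat.add_sub_cancel]
    refine if_congr ?_ rfl rfl
    push_cast
    constructor
    · rintro ⟨-, h⟩
      linarith
    · intro h
      exact ⟨by omega, by linarith⟩
  rw [hc]
  abel

/-- The mixed terms contain a single bilinear operator and have zero expectation. The product of
central terms is what inclusion-exclusion later removes. -/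
theorem vacExp_mul_bracket (q : ℕ) (f g : ℤ → ℚ) (s t : ℤ) (j l : ℕ) :
    vacExp (alphaBracket q f s j * alphaBracket q g t l)
      = vacExp (bilinear ((backwardDiff q)^[j] f) (s - q * j)
          * bilinear ((backwardDiff q)^[l] g) (t - q * l))
        + centralTerm q f s j * centralTerm q g t l := by
  have h1 := vacExp_bilinear ((backwardDiff q)^[j] f) (s - q * j)
  have h2 := vacExp_bilinear ((backwardDiff q)^[l] g) (t - q * l)
  rw [vacExp_apply] at h1 h2
  simp only [alphaBracket, vacExp_apply, Module.End.mul_apply, LinearMap.add_apply,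
    LinearMap.smul_apply, Module.End.one_apply, map_add, map_smul, Finsupp.add_apply,
    Finsupp.smul_apply, h1, h2, smul_eq_mul, Finsupp.single_eq_same]
  ring

open Finset in
theorem alpha_pow_mul_bilinear {q : ℕ} (hq : 0 < q) (f : ℤ → ℚ) (s : ℤ) (d : ℕ) :
    alpha q ^ d * bilinear f s
      = ∑ p ∈ antidiagonal d, d.choose p.1 • (alphaBracket q f s p.1 * alpha q ^ p.2) := by
  rw [← pow_mul_eq_sum_of_commutator (alpha_mul_alphaBracket hq f s) d, alphaBracket_zero]

open Finset in
theorem completedCycle_pow_mul_bilinear (m : ℕ) (s : ℤ) (b : ℕ) :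
    completedCycle m ^ b * bilinear (fun _ => 1) s
      = ∑ p ∈ antidiagonal b,
          b.choose p.1 • (bilinear (powerDiff m s ^ p.1) s * completedCycle m ^ p.2) := by
  have := pow_mul_eq_sum_of_commutator (A := completedCycle m)
    (B := fun j => bilinear (powerDiff m s ^ j) s)
    (fun j => by rw [completedCycle_mul_bilinear, pow_succ]) b
  rw [← this, pow_zero]
  rfl

theorem pow_vac_of_vac {A : Module.End ℚ Wedge} (hA : A vac = 0) {n : ℕ} (hn : n ≠ 0) :
    (A ^ n) vac = 0 := by
  obtain ⟨m, rfl⟩ := Nat.exists_eq_succ_of_ne_zero hn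
  rw [pow_succ, Module.End.mul_apply, hA, map_zero]

open Finset in
theorem sum_mul_pow_vac {A : Module.End ℚ Wedge} (hA : A vac = 0) (B : ℕ → Module.End ℚ Wedge)
    (n : ℕ) :
    (∑ p ∈ antidiagonal n, n.choose p.1 • (B p.1 * A ^ p.2)) vac = B n vac := by
  rw [LinearMap.sum_apply, sum_eq_single (n, 0)]
  · simp
  · intro p hp hne
    have h2 : p.2 ≠ 0 := fun h => hne (Prod.ext (by have := mem_antidiagonal.1 hp; omega) h)
    rw [LinearMap.smul_apply, Module.End.mul_apply, pow_vac_of_vac hA h2, map_zero, smul_zero]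
  · simp

theorem alpha_neg {μ : ℕ} (hμ : 0 < μ) : alpha (-(μ : ℤ)) = bilinear (fun _ => 1) μ := by
  rw [alpha_eq_bilinear (by omega), neg_neg]

theorem completedCycle_pow_alpha_vac (m b : ℕ) {μ : ℕ} (hμ : 0 < μ) :
    (completedCycle m ^ b) (alpha (-(μ : ℤ)) vac) = bilinear (powerDiff m μ ^ b) μ vac := by
  rw [alpha_neg hμ, ← Module.End.mul_apply, completedCycle_pow_mul_bilinear,
    sum_mul_pow_vac (completedCycle_vac m) (fun j => bilinear (powerDiff m μ ^ j) μ)]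

theorem alpha_pow_bilinear_vac {q : ℕ} (hq : 0 < q) (f : ℤ → ℚ) (s : ℤ) (d : ℕ) :
    (alpha q ^ d) (bilinear f s vac) = alphaBracket q f s d vac := by
  rw [← Module.End.mul_apply, alpha_pow_mul_bilinear hq,
    sum_mul_pow_vac (alpha_vac (by exact_mod_cast hq)) (alphaBracket q f s)]

theorem vacExp_one_point {q : ℕ} (hq : 0 < q) (m b d : ℕ) {μ : ℕ} (hμ : 0 < μ) :
    vacExp (alpha q ^ d * completedCycle m ^ b * alpha (-(μ : ℤ)))
      = centralTerm q (powerDiff m μ ^ b) μ d := by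
  have h := vacExp_bilinear ((backwardDiff q)^[d] (powerDiff m μ ^ b)) (μ - q * d)
  rw [vacExp_apply] at h
  rw [vacExp_apply, Module.End.mul_apply, Module.End.mul_apply, completedCycle_pow_alpha_vac m b hμ,
    alpha_pow_bilinear_vac hq, alphaBracket]
  simp [h]

open Finset in
-- By the Leibniz expansion the `b` completed cycles and the `d` copies of α_q are distributed over
-- the two operators; whatever passes both kills the vacuum.
theorem vacExp_two_point {q : ℕ} (hq : 0 < q) (m b d : ℕ) {μ ν : ℕ} (hμ : 0 < μ) (hν : 0 < ν) :
    vacExp (alpha q ^ d * completedCycle m ^ b * (alpha (-(μ : ℤ)) * alpha (-(ν : ℤ))))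
      = ∑ p ∈ antidiagonal b, (b.choose p.1 : ℚ) * ∑ t ∈ antidiagonal d, (d.choose t.1 : ℚ) *
          vacExp (alphaBracket q (powerDiff m μ ^ p.1) μ t.1
            * alphaBracket q (powerDiff m ν ^ p.2) ν t.2) := by
  have h1 : (completedCycle m ^ b) (alpha (-(μ : ℤ)) (alpha (-(ν : ℤ)) vac))
      = ∑ p ∈ antidiagonal b, b.choose p.1 •
          bilinear (powerDiff m μ ^ p.1) μ (bilinear (powerDiff m ν ^ p.2) ν vac) := by
    rw [alpha_neg hμ, ← Module.End.mul_apply, completedCycle_pow_mul_bilinear,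
      LinearMap.sum_apply]
    refine sum_congr rfl fun p _ => ?_
    rw [LinearMap.smul_apply, Module.End.mul_apply, completedCycle_pow_alpha_vac m _ hν]
  have h2 : ∀ f g : ℤ → ℚ, (alpha q ^ d) (bilinear f μ (bilinear g ν vac))
      = ∑ t ∈ antidiagonal d, d.choose t.1 •
          alphaBracket q f μ t.1 (alphaBracket q g ν t.2 vac) := by
    intro f g
    rw [← Module.End.mul_apply, alpha_pow_mul_bilinear hq, LinearMap.sum_apply]
    refine sum_congr rfl fun t _ => ?_
    rw [LinearMap.smul_apply, Module.End.mul_apply, alpha_pow_bilinear_vac hq]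
  rw [vacExp_apply]
  simp only [Module.End.mul_apply]
  rw [h1, map_sum, Finsupp.finsetSum_apply]
  refine sum_congr rfl fun p _ => ?_
  rw [map_nsmul, h2, Finsupp.smul_apply, Finsupp.finsetSum_apply, nsmul_eq_mul]
  congr 1

end

end SpinHurwitz

namespace SpinHurwitz

noncomputable section

open scoped Nat

/-! ### Hurwitz numbers -/

theorem hurwitzDisc_singleton {q r b μ : ℕ} (hq : 0 < q) (hμ : 0 < μ) :
    hurwitzDisc q r b [μ] = if q ∣ μ then
      ((q : ℚ) ^ (μ / q) * ((μ / q)! : ℚ))⁻¹ * (((r : ℚ) + 1) ^ b)⁻¹ * (μ : ℚ)⁻¹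
        * centralTerm q (powerDiff (r + 1) μ ^ b) μ (μ / q) else 0 := by
  unfold hurwitzDisc
  simp only [List.sum_singleton, List.map_singleton, List.prod_singleton]
  refine if_congr Iff.rfl ?_ rfl
  rw [← vacExp_one_point hq (r + 1) b (μ / q) hμ]
  simp only [vacExp_apply, smul_mul_assoc, mul_smul_comm, LinearMap.smul_apply, Finsupp.smul_apply,
    smul_eq_mul]
  ring

open Finset in
theorem hurwitzDisc_pair {q r b μ ν : ℕ} (hq : 0 < q) (hμ : 0 < μ) (hν : 0 < ν) {d : ℕ}
    (hd : μ + ν = q * d) :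
    hurwitzDisc q r b [μ, ν]
      = ((q : ℚ) ^ d * (d ! : ℚ))⁻¹ * (((r : ℚ) + 1) ^ b)⁻¹ * (μ : ℚ)⁻¹ * (ν : ℚ)⁻¹ *
        ∑ p ∈ antidiagonal b, (b.choose p.1 : ℚ) * ∑ t ∈ antidiagonal d, (d.choose t.1 : ℚ) *
          vacExp (alphaBracket q (powerDiff (r + 1) μ ^ p.1) μ t.1
            * alphaBracket q (powerDiff (r + 1) ν ^ p.2) ν t.2) := by
  have hsum : ([μ, ν] : List ℕ).sum = q * d := by simp [hd]
  unfold hurwitzDisc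
  rw [hsum, if_pos (dvd_mul_right _ _), Nat.mul_div_cancel_left _ hq,
    ← vacExp_two_point hq (r + 1) b d hμ hν]
  simp only [List.map_cons, List.map_nil, List.prod_cons, List.prod_nil, mul_one, vacExp_apply,
    smul_mul_assoc, mul_smul_comm, LinearMap.smul_apply, Finsupp.smul_apply, smul_eq_mul]
  ring

open Finset in
theorem sum_piAntidiag_singleton {ι : Type*} [DecidableEq ι] (a : ι) (b : ℕ) (F : ℕ → ℚ) :
    ∑ c ∈ piAntidiag ({a} : Finset ι) b, F (c a) = F b := by
  rw [sum_eq_single (Pi.single a b)]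
  · simp
  · intro c hc hne
    rw [mem_piAntidiag, sum_singleton] at hc
    refine absurd (funext fun i => ?_) hne
    rcases eq_or_ne i a with rfl | hi
    · simp [hc.1]
    · rw [Pi.single_eq_of_ne hi]
      by_contra h
      exact hi (mem_singleton.1 (hc.2 i h))
  · intro h
    refine absurd (mem_piAntidiag.2 ⟨by simp, fun i hi => ?_⟩) h
    by_contra h'
    exact hi (Pi.single_eq_of_ne (by simpa using h') _)

open Finset in
theorem hurwitzConn_one (q r b : ℕ) (μ : Fin 1 → ℕ) :
    hurwitzConn q r b μ = hurwitzDisc q r b [μ 0] := by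
  have hP : ∀ P : Finpartition (univ : Finset (Fin 1)), P.parts = {univ} := by
    intro P
    obtain ⟨t, ht, h0⟩ := P.exists_mem (mem_univ (0 : Fin 1))
    have huniv : ∀ s ∈ P.parts, s = univ := by
      intro s hs
      obtain ⟨i, hi⟩ := P.nonempty_of_mem_parts hs
      ext j
      rw [Subsingleton.elim j i]
      simp only [hi, mem_univ]
    refine eq_singleton_iff_unique_mem.2 ⟨huniv t ht ▸ ht, huniv⟩
  have hU : (univ : Finset (Finpartition (univ : Finset (Fin 1)))) = {⊤} :=
    eq_singleton_iff_unique_mem.2 ⟨mem_univ _, fun P _ =>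
      Finpartition.ext (by rw [hP P, hP ⊤])⟩
  unfold hurwitzConn
  rw [hU, sum_singleton, hP]
  have hsort : ((univ : Finset (Fin 1)).sort (· ≤ ·)).map μ = [μ 0] := by
    rw [show (univ : Finset (Fin 1)) = {0} from rfl, sort_singleton]
    rfl
  have hb : (b ! : ℚ) ≠ 0 := by exact_mod_cast b.factorial_ne_zero
  simp only [card_singleton, prod_singleton, hsort]
  rw [sum_piAntidiag_singleton univ b (fun c => hurwitzDisc q r c [μ 0] / (c ! : ℚ))]
  simp
  field_simp

open Finset in
-- A two-element set has only the partitions `⊤` and `⊥`, with weights 1 and -1.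
theorem hurwitzConn_two (q r b : ℕ) (μ : Fin 2 → ℕ) :
    hurwitzConn q r b μ / (b ! : ℚ) = hurwitzDisc q r b [μ 0, μ 1] / (b ! : ℚ)
      - ∑ p ∈ antidiagonal b, hurwitzDisc q r p.1 [μ 0] / (p.1 ! : ℚ)
          * (hurwitzDisc q r p.2 [μ 1] / (p.2 ! : ℚ)) := by
  have hne : ({0} : Finset (Fin 2)) ≠ {1} := by decide
  set T : Finpartition (univ : Finset (Fin 2)) := ⊤ with hT
  set B : Finpartition (univ : Finset (Fin 2)) := ⊥ with hB
  have hTp : T.parts = {univ} := rfl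
  have hBp : B.parts = {{0}, {1}} := rfl
  have hU : (univ : Finset (Finpartition (univ : Finset (Fin 2)))) = {T, B} := by
    refine (eq_univ_iff_forall.2 fun P => ?_).symm
    rw [mem_insert, mem_singleton]
    obtain ⟨s, hs, h0⟩ := P.exists_mem (mem_univ (0 : Fin 2))
    obtain ⟨t, ht, h1⟩ := P.exists_mem (mem_univ (1 : Fin 2))
    by_cases hst : s = t
    · left
      subst hst
      have hsu : s = univ := by
        ext i
        fin_cases i <;> simp [h0, h1]
      refine Finpartition.ext ?_
      rw [hTp, eq_singleton_iff_unique_mem]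
      refine ⟨hsu ▸ hs, fun u hu => ?_⟩
      obtain ⟨i, hi⟩ := P.nonempty_of_mem_parts hu
      rw [← hsu]
      exact P.eq_of_mem_parts hu hs hi (by rw [hsu]; exact mem_univ i)
    · right
      have hs0 : s = {0} := by
        ext i
        fin_cases i
        · simp [h0]
        · simpa using fun h => hst (P.eq_of_mem_parts hs ht h h1)
      have ht1 : t = {1} := by
        ext i
        fin_cases i
        · simpa using fun h => hst (P.eq_of_mem_parts hs ht h0 h)
        · simp [h1]
      refine Finpartition.ext ?_
      rw [hBp]
      ext u
      rw [mem_insert, mem_singleton]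
      constructor
      · intro hu
        obtain ⟨i, hi⟩ := P.nonempty_of_mem_parts hu
        fin_cases i
        · exact Or.inl ((P.eq_of_mem_parts hu hs hi h0).trans hs0)
        · exact Or.inr ((P.eq_of_mem_parts hu ht hi h1).trans ht1)
      · rintro (rfl | rfl)
        · exact hs0 ▸ hs
        · exact ht1 ▸ ht
  have hTB : T ≠ B := by
    intro h
    have := congrArg (fun P => P.parts.card) h
    simp [hTp, hBp, card_pair hne] at this
  have hb : (b ! : ℚ) ≠ 0 := by exact_mod_cast b.factorial_ne_zero
  have hsort : ((univ : Finset (Fin 2)).sort (· ≤ ·)).map μ = [μ 0, μ 1] := by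
    have : (univ : Finset (Fin 2)).sort (· ≤ ·) = [0, 1] := by
      simpa [List.finRange] using Fin.sort_univ 2
    rw [this]
    rfl
  -- Elements of `piAntidiag` vanish off the two blocks, unlike the function on the right; the
  -- hypothesis on `F` makes values elsewhere irrelevant.
  have hanti : ∀ F : (Finset (Fin 2) → ℕ) → ℚ, (∀ c c', c {0} = c' {0} → c {1} = c' {1} → F c = F c') →
      ∑ c ∈ piAntidiag ({{0}, {1}} : Finset (Finset (Fin 2))) b, F c
        = ∑ p ∈ antidiagonal b, F (fun s => if s = {0} then p.1 else p.2) := by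
    intro F hF
    refine sum_nbij' (fun c => (c {0}, c {1}))
      (fun p s => if s = {0} then p.1 else if s = {1} then p.2 else 0) ?_ ?_ ?_ ?_ ?_
    · intro c hc
      rw [mem_piAntidiag] at hc
      simpa [sum_pair hne] using hc.1
    · intro p hp
      rw [mem_piAntidiag]
      rw [HasAntidiagonal.mem_antidiagonal] at hp
      refine ⟨by simpa [sum_pair hne, hne.symm] using hp, ?_⟩
      intro s
      simp only [mem_insert, mem_singleton]
      grind
    · intro c hc
      rw [mem_piAntidiag] at hc
      funext s
      dsimp only
      split_ifs with h h'
      · rw [h]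
      · rw [h']
      · by_contra h0
        have := hc.2 s (Ne.symm h0)
        simp [h, h'] at this
    · intro p _
      simp [hne.symm]
    · intro c _
      exact hF _ _ (by simp) (by simp [hne.symm])
  unfold hurwitzConn
  rw [hU, sum_pair hTB, hTp, hBp, card_pair hne, hanti]
  · simp only [card_singleton, prod_singleton, prod_pair hne, hsort,
      sort_singleton, List.map_cons, List.map_nil, if_true, hne.symm, if_false]
    rw [sum_piAntidiag_singleton univ b (fun c => hurwitzDisc q r c [μ 0, μ 1] / (c ! : ℚ))]
    simp
    field_simp
    ring
  · intro c c' h0 h1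
    simp only [prod_pair hne, h0, h1]

end

end SpinHurwitz

/-! ### Genus-zero Hurwitz numbers with one and two parts. -/

namespace SpinHurwitz

noncomputable section

open scoped Nat

/-- There are `r * b + 1` commutators with α_q. The first `r * b` difference a polynomial of degree
`r * b` to a constant; the last is the central term, summing this constant over `q` places. -/
theorem hurwitzDisc_genus_zero {q r : ℕ} (hq : 0 < q) (b : ℕ) {μ : ℕ} (hμ : μ = q + q * r * b) :
    hurwitzDisc q r b [μ] / (b ! : ℚ) = q * (μ : ℚ) ^ b / ((b ! : ℚ) * (μ : ℚ) ^ 2) := by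
  have hμ0 : 0 < μ := by omega
  have hμd : μ = q * (r * b + 1) := by rw [hμ]; ring
  have hdiv : μ / q = r * b + 1 := by rw [hμd, Nat.mul_div_cancel_left _ hq]
  rw [hurwitzDisc_singleton hq hμ0, if_pos (hμd ▸ dvd_mul_right _ _), hdiv, centralTerm,
    if_pos ⟨by omega, by rw [hμd]; push_cast; ring⟩, Nat.add_sub_cancel,
    iterate_backwardDiff_powerDiff_pow q r b μ le_rfl]
  simp only [if_true, Finset.sum_const, Int.card_Ico, sub_neg_eq_add, zero_add, Int.toNat_natCast,
    nsmul_eq_mul, Int.cast_natCast]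
  rw [Nat.factorial_succ]
  have h1 : (q : ℚ) ≠ 0 := by exact_mod_cast hq.ne'
  have h2 : ((r * b)! : ℚ) ≠ 0 := by exact_mod_cast (r * b).factorial_ne_zero
  have h3 : (μ : ℚ) ≠ 0 := by exact_mod_cast hμ0.ne'
  have h4 : (μ : ℚ) = q * (r * b + 1) := by exact_mod_cast hμd
  have h5 : ((r : ℚ) * b + 1) ≠ 0 := by positivity
  have h6 : ((r : ℚ) + 1) ≠ 0 := by positivity
  have h7 : (b ! : ℚ) ≠ 0 := by exact_mod_cast b.factorial_ne_zero
  push_cast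
  rw [mul_pow, pow_succ]
  field_simp
  rw [h4]

open Finset in
-- Both central terms are nonzero only for `q * t.1 = μ` and `q * t.2 = ν`; the binomials then split
-- the factorials of `b` and `d` into those of two one-part numbers. If `q` does not divide `μ`,
-- both sides vanish.
theorem sum_centralTerm_mul {q r b d : ℕ} (hq : 0 < q) {μ ν : ℕ} (hμ : 0 < μ) (hν : 0 < ν)
    (hd : μ + ν = q * d) (p : ℕ × ℕ) (hp : p ∈ antidiagonal b) :
    ((q : ℚ) ^ d * (d ! : ℚ))⁻¹ * (((r : ℚ) + 1) ^ b)⁻¹ * (μ : ℚ)⁻¹ * (ν : ℚ)⁻¹ *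
        ((b.choose p.1 : ℚ) * ∑ t ∈ antidiagonal d, (d.choose t.1 : ℚ) *
          (centralTerm q (powerDiff (r + 1) μ ^ p.1) μ t.1
            * centralTerm q (powerDiff (r + 1) ν ^ p.2) ν t.2)) / (b ! : ℚ)
      = hurwitzDisc q r p.1 [μ] / (p.1 ! : ℚ) * (hurwitzDisc q r p.2 [ν] / (p.2 ! : ℚ)) := by
  obtain ⟨b₁, b₂⟩ := p
  rw [HasAntidiagonal.mem_antidiagonal] at hp
  dsimp only at hp ⊢
  subst hp
  rw [hurwitzDisc_singleton hq hμ, hurwitzDisc_singleton hq hν]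
  by_cases hdvd : q ∣ μ
  · obtain ⟨j, rfl⟩ := hdvd
    have hdvd' : q ∣ ν := (Nat.dvd_add_right (dvd_mul_right q j)).1 (hd ▸ dvd_mul_right q d)
    obtain ⟨l, rfl⟩ := hdvd'
    have hjl : j + l = d := Nat.eq_of_mul_eq_mul_left hq (by rw [← hd]; ring)
    subst hjl
    rw [if_pos (dvd_mul_right _ _), if_pos (dvd_mul_right _ _), Nat.mul_div_cancel_left _ hq,
      Nat.mul_div_cancel_left _ hq, sum_eq_single (j, l)]
    · dsimp only
      rw [Nat.cast_add_choose, Nat.cast_add_choose]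
      have h1 : (q : ℚ) ≠ 0 := by exact_mod_cast hq.ne'
      have h2 (n : ℕ) : (n ! : ℚ) ≠ 0 := by exact_mod_cast n.factorial_ne_zero
      have h3 : ((r : ℚ) + 1) ≠ 0 := by positivity
      have h4 := h2 b₁
      have h5 := h2 b₂
      have h6 := h2 j
      have h7 := h2 l
      have h8 := h2 (b₁ + b₂)
      have h9 := h2 (j + l)
      rw [pow_add, pow_add]
      field_simp
    · rintro ⟨j', l'⟩ _ hne
      dsimp only
      by_cases hj : j' = j
      · have hl : l' ≠ l := fun h => hne (by rw [hj, h])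
        rw [centralTerm, centralTerm, if_neg (c := 0 < l' ∧ _), mul_zero, mul_zero]
        rintro ⟨-, h⟩
        push_cast at h
        exact hl (Nat.eq_of_mul_eq_mul_left hq (by exact_mod_cast h.symm))
      · rw [centralTerm, if_neg, zero_mul, mul_zero]
        rintro ⟨-, h⟩
        push_cast at h
        exact hj (Nat.eq_of_mul_eq_mul_left hq (by exact_mod_cast h.symm))
    · intro h
      exact absurd (HasAntidiagonal.mem_antidiagonal (a := (j, l)).2 rfl) h
  · rw [if_neg hdvd, zero_div, zero_mul, sum_eq_zero]
    · simp
    · intro t _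
      rw [centralTerm, if_neg, zero_mul, mul_zero]
      rintro ⟨-, h⟩
      exact hdvd ⟨t.1, by exact_mod_cast h⟩

open Finset in
-- The orders of difference add up to `r * b`, the sum of the two degree bounds `r * p.1` and `r *
-- p.2`. Unless each order matches its bound, one exceeds it and that factor is zero. What remains
-- is a two-point function of constants.
theorem sum_vacExp_bilinear_mul {q r b : ℕ} (hq : 0 < q) {μ ν : ℕ} (hμ : 0 < μ) (hν : 0 < ν)
    (hb : μ + ν = q * (r * b)) (p : ℕ × ℕ) (hp : p ∈ antidiagonal b) :
    ((q : ℚ) ^ (r * b) * ((r * b)! : ℚ))⁻¹ * (((r : ℚ) + 1) ^ b)⁻¹ * (μ : ℚ)⁻¹ * (ν : ℚ)⁻¹ *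
        ((b.choose p.1 : ℚ) * ∑ t ∈ antidiagonal (r * b), ((r * b).choose t.1 : ℚ) *
          vacExp (bilinear ((backwardDiff q)^[t.1] (powerDiff (r + 1) μ ^ p.1)) (μ - q * t.1)
            * bilinear ((backwardDiff q)^[t.2] (powerDiff (r + 1) ν ^ p.2)) (ν - q * t.2)))
          / (b ! : ℚ)
      = (if q * r * p.2 < ν then (ν : ℚ) - q * r * p.2 else 0) *
          ((μ : ℚ) ^ p.1 / (p.1 ! : ℚ) * ((ν : ℚ) ^ p.2 / (p.2 ! : ℚ))) / (μ * ν) := by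
  obtain ⟨b₁, b₂⟩ := p
  rw [HasAntidiagonal.mem_antidiagonal] at hp
  dsimp only at hp ⊢
  subst hp
  have hbil0 (s : ℤ) : bilinear (fun _ => 0) s = 0 := bilinear_zero s
  rw [sum_eq_single (r * b₁, r * b₂)]
  · dsimp only
    rw [iterate_backwardDiff_powerDiff_pow _ _ _ _ le_rfl,
      iterate_backwardDiff_powerDiff_pow _ _ _ _ le_rfl, if_pos rfl, if_pos rfl]
    have hs : (μ : ℤ) - q * (r * b₁ : ℕ) = -((ν : ℤ) - q * (r * b₂ : ℕ)) := by
      have : (μ : ℤ) + ν = q * (r * (b₁ + b₂)) := by exact_mod_cast hb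
      push_cast
      linarith
    rw [hs, vacExp_const_mul_const, mul_add r, Nat.cast_add_choose, Nat.cast_add_choose]
    have hcond : (0 < (ν : ℤ) - q * (r * b₂ : ℕ)) ↔ q * r * b₂ < ν := by
      rw [sub_pos]
      push_cast
      rw [← mul_assoc]
      exact_mod_cast Iff.rfl
    have h1 : (q : ℚ) ≠ 0 := by exact_mod_cast hq.ne'
    have h2 (n : ℕ) : (n ! : ℚ) ≠ 0 := by exact_mod_cast n.factorial_ne_zero
    have h3 : ((r : ℚ) + 1) ≠ 0 := by positivity
    have h4 := h2 b₁
    have h5 := h2 b₂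
    have h6 := h2 (r * b₁)
    have h7 := h2 (r * b₂)
    have h8 := h2 (b₁ + b₂)
    have h9 := h2 (r * b₁ + r * b₂)
    have h10 : (μ : ℚ) ≠ 0 := by exact_mod_cast hμ.ne'
    have h11 : (ν : ℚ) ≠ 0 := by exact_mod_cast hν.ne'
    simp only [hcond]
    split_ifs
    · push_cast
      rw [pow_add, pow_add, mul_pow, mul_pow]
      field_simp
    · simp
  · rintro ⟨j, l⟩ ht hne
    rw [HasAntidiagonal.mem_antidiagonal, mul_add] at ht
    dsimp only at ht ⊢
    rcases lt_trichotomy j (r * b₁) with h | h | h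
    · rw [iterate_backwardDiff_powerDiff_pow _ _ b₂ _ (j := l) (by omega), if_neg (by omega),
        hbil0, mul_zero]
      simp [vacExp_apply]
    · exact absurd (Prod.ext h (by dsimp only; omega)) hne
    · rw [iterate_backwardDiff_powerDiff_pow _ _ b₁ _ (j := j) (by omega), if_neg (by omega),
        hbil0, zero_mul]
      simp [vacExp_apply]
  · intro h
    exact absurd (HasAntidiagonal.mem_antidiagonal.2 (mul_add _ _ _).symm) h

open Finset in
theorem hurwitzConn_genus_zero_two {q r b : ℕ} (hq : 0 < q) {μ : Fin 2 → ℕ} (h0 : 0 < μ 0)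
    (h1 : 0 < μ 1) (hb : μ 0 + μ 1 = q * r * b) :
    hurwitzConn q r b μ / (b ! : ℚ)
      = ∑ p ∈ antidiagonal b, (if q * r * p.2 < μ 1 then (μ 1 : ℚ) - q * r * p.2 else 0) *
          ((μ 0 : ℚ) ^ p.1 / (p.1 ! : ℚ) * ((μ 1 : ℚ) ^ p.2 / (p.2 ! : ℚ))) / (μ 0 * μ 1) := by
  rw [mul_assoc] at hb
  rw [hurwitzConn_two, hurwitzDisc_pair hq h0 h1 hb, mul_sum, sum_div, ← sum_sub_distrib]
  refine sum_congr rfl fun p hp => ?_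
  rw [← sum_centralTerm_mul hq h0 h1 hb p hp, ← sum_vacExp_bilinear_mul hq h0 h1 hb p hp,
    ← sub_div, ← mul_sub, ← mul_sub, ← sum_sub_distrib]
  simp only [vacExp_mul_bracket, mul_add, add_sub_cancel_right]

/-! ### Coefficients of the correlators -/

open MvPowerSeries in
theorem coeff_correlator_one {q r : ℕ} (hq : 0 < q) (hr : 0 < r) (μ : Fin 1 →₀ ℕ) :
    coeff μ (correlator q r 0 1)
      = if q ≤ μ 0 ∧ q * r ∣ μ 0 - q then
          (q : ℚ) * (μ 0 : ℚ) ^ ((μ 0 - q) / (q * r))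
            / ((((μ 0 - q) / (q * r))! : ℚ) * (μ 0 : ℚ) ^ 2) else 0 := by
  have hram : ramification q 0 1 (∑ i, μ i) = (μ 0 : ℤ) - q := by
    simp [ramification]
    ring
  change correlator q r 0 1 μ = _
  unfold correlator
  simp only [hram]
  by_cases h : q ≤ μ 0 ∧ q * r ∣ μ 0 - q
  · obtain ⟨h1, h2⟩ := h
    have e : (μ 0 : ℤ) - q = ((μ 0 - q : ℕ) : ℤ) := by push_cast [h1]; ring
    obtain ⟨b, hb⟩ := h2
    rw [e, if_pos (c := q ≤ μ 0 ∧ q * r ∣ μ 0 - q) ⟨h1, ⟨b, hb⟩⟩, if_pos, hurwitzConn_one]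
    · rw [hb]
      have e2 : ((((q * r * b : ℕ) : ℤ)) / ((q : ℤ) * r)).toNat = b := by
        push_cast
        rw [Int.mul_ediv_cancel_left _ (by positivity), Int.toNat_natCast]
      rw [e2, Nat.mul_div_cancel_left _ (by positivity)]
      exact hurwitzDisc_genus_zero hq b (by omega)
    · refine ⟨fun i => ?_, by positivity, ⟨b, by exact_mod_cast hb⟩⟩
      rw [Subsingleton.elim i 0]
      omega
  · rw [if_neg, if_neg h]
    rintro ⟨-, h1, h2⟩
    have h3 : q ≤ μ 0 := by omega
    refine h ⟨h3, ?_⟩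
    have e : (μ 0 : ℤ) - q = ((μ 0 - q : ℕ) : ℤ) := by push_cast [h3]; ring
    rw [e] at h2
    exact_mod_cast h2

open MvPowerSeries Finset in
theorem coeff_correlator_two {q r : ℕ} (hq : 0 < q) (hr : 0 < r) (μ : Fin 2 →₀ ℕ) :
    coeff μ (correlator q r 0 2)
      = if 0 < μ 0 ∧ 0 < μ 1 ∧ q * r ∣ μ 0 + μ 1 then
          ∑ p ∈ antidiagonal ((μ 0 + μ 1) / (q * r)),
            (if q * r * p.2 < μ 1 then (μ 1 : ℚ) - q * r * p.2 else 0) *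
            ((μ 0 : ℚ) ^ p.1 / (p.1 ! : ℚ) * ((μ 1 : ℚ) ^ p.2 / (p.2 ! : ℚ))) / (μ 0 * μ 1)
        else 0 := by
  have hram : ramification q 0 2 (∑ i, μ i) = ((μ 0 + μ 1 : ℕ) : ℤ) := by
    simp [ramification]
  change correlator q r 0 2 μ = _
  unfold correlator
  simp only [hram]
  by_cases h : 0 < μ 0 ∧ 0 < μ 1 ∧ q * r ∣ μ 0 + μ 1
  · obtain ⟨h1, h2, b, hb⟩ := h
    have hpos : ∀ i, 0 < μ i := Fin.forall_fin_two.2 ⟨h1, h2⟩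
    have e2 : ((((q * r * b : ℕ) : ℤ)) / ((q : ℤ) * r)).toNat = b := by
      push_cast
      rw [Int.mul_ediv_cancel_left _ (by positivity), Int.toNat_natCast]
    rw [if_pos (c := 0 < μ 0 ∧ 0 < μ 1 ∧ q * r ∣ μ 0 + μ 1) ⟨h1, h2, b, hb⟩,
      if_pos ⟨hpos, by positivity, ⟨b, by rw [hb]; push_cast; ring⟩⟩, hb, e2,
      Nat.mul_div_cancel_left _ (by positivity)]
    exact hurwitzConn_genus_zero_two hq h1 h2 hb
  · rw [if_neg, if_neg h]
    rintro ⟨h0, -, h2⟩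
    exact h ⟨h0 0, h0 1, by exact_mod_cast h2⟩

end

end SpinHurwitz

namespace SpinHurwitz

noncomputable section

open scoped Nat

/-! ### Lagrange inversion for x = z e^{-z^N}. -/

section Univariate

open PowerSeries

/-- The series `e^{z^N}`. -/
def expPow (N : ℕ) : PowerSeries ℚ := (exp ℚ).subst (X ^ N : PowerSeries ℚ)

theorem expPow_pow {N : ℕ} (hN : N ≠ 0) (n : ℕ) :
    expPow N ^ n = (rescale (n : ℚ) (exp ℚ)).subst (X ^ N : PowerSeries ℚ) := by
  rw [expPow, ← exp_pow_eq_rescale_exp, subst_pow (HasSubst.X_pow hN)]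

theorem coeff_expPow_pow {N : ℕ} (hN : N ≠ 0) (n k : ℕ) :
    coeff k (expPow N ^ n)
      = if N ∣ k then (n : ℚ) ^ (k / N) / ((k / N)! : ℚ) else 0 := by
  rw [expPow_pow hN, coeff_subst_X_pow hN]
  simp [coeff_rescale, coeff_exp, div_eq_mul_inv]

theorem derivative_expPow {N : ℕ} (hN : N ≠ 0) :
    d⁄dX ℚ (expPow N) = expPow N * ((N : PowerSeries ℚ) * X ^ (N - 1)) := by
  rw [expPow, derivative_subst (HasSubst.X_pow hN), derivative_exp, derivative_pow, derivative_X,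
    mul_one]

theorem coeff_X_mul_derivative (f : PowerSeries ℚ) (n : ℕ) :
    coeff n (X * d⁄dX ℚ f) = n * coeff n f := by
  cases n with
  | zero => simp
  | succ n => rw [coeff_succ_X_mul, coeff_derivative]; push_cast; ring

/-- Compare coefficients of degree `m` in z d/dz e^{m z^N} = m N z^N e^{m z^N} and cancel `m`. -/
theorem coeff_expPow_pow_mul {N : ℕ} (hN : N ≠ 0) {m : ℕ} (hm : m ≠ 0) :
    coeff m (expPow N ^ m * (1 - (N : PowerSeries ℚ) * X ^ N)) = 0 := by
  have h1 : X * d⁄dX ℚ (expPow N ^ m)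
      = (m : PowerSeries ℚ) * ((N : PowerSeries ℚ) * (expPow N ^ m * X ^ N)) := by
    obtain ⟨k, rfl⟩ := Nat.exists_eq_succ_of_ne_zero hm
    obtain ⟨l, rfl⟩ := Nat.exists_eq_succ_of_ne_zero hN
    rw [derivative_pow, derivative_expPow hN]
    simp only [Nat.succ_sub_one, Nat.succ_eq_add_one]
    ring
  have h2 := congrArg (coeff m) h1
  rw [coeff_X_mul_derivative, show ((m : ℕ) : PowerSeries ℚ) = C (m : ℚ) by simp, coeff_C_mul] at h2
  have h3 := mul_left_cancel₀ (by exact_mod_cast hm : (m : ℚ) ≠ 0) h2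
  rw [mul_sub, mul_one, map_sub, h3, mul_left_comm, sub_self]

theorem exp_subst_neg_pow_mul {N : ℕ} (hN : N ≠ 0) :
    (exp ℚ).subst (-X ^ N : PowerSeries ℚ) * expPow N = 1 := by
  have h1 : HasSubst (-X : PowerSeries ℚ) := HasSubst.of_constantCoeff_zero' (by simp)
  have h2 : evalNegHom (exp ℚ) = (exp ℚ).subst (-X : PowerSeries ℚ) := by
    rw [evalNegHom, rescale_eq_subst]
    congr 1
    simp
  have h3 : (-X ^ N : PowerSeries ℚ) = (-X : PowerSeries ℚ).subst (X ^ N : PowerSeries ℚ) := by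
    rw [← coe_substAlgHom (HasSubst.X_pow hN), map_neg, coe_substAlgHom (HasSubst.X_pow hN),
      subst_X (HasSubst.X_pow hN)]
  rw [h3, ← subst_comp_subst_apply h1 (HasSubst.X_pow hN), ← h2, expPow,
    ← subst_mul (HasSubst.X_pow hN), mul_comm, exp_mul_exp_neg_eq_one,
    ← coe_substAlgHom (HasSubst.X_pow hN), map_one]

theorem hasSubst_xOfZ (q r : ℕ) : HasSubst (xOfZ q r) :=
  HasSubst.of_constantCoeff_zero' (constantCoeff_xOfZ q r)

variable (q r : ℕ) [NeZero q] [NeZero r]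

theorem mul_ne_zero_of_neZero : q * r ≠ 0 := mul_ne_zero (NeZero.ne q) (NeZero.ne r)

/-- The functional form of Lagrange inversion for `x = z e^{-z^N}`. -/
theorem coeff_subst_xOfZ_mul (n : ℕ) (H : PowerSeries ℚ) :
    coeff n (H.subst (xOfZ q r) *
      (expPow (q * r) ^ n * (1 - ((q * r : ℕ) : PowerSeries ℚ) * X ^ (q * r)))) = coeff n H := by
  have hN := mul_ne_zero_of_neZero q r
  have hx := hasSubst_xOfZ q r
  have hdec (H : PowerSeries ℚ) : H.subst (xOfZ q r)
      = xOfZ q r * (mk fun p => coeff (p + 1) H).subst (xOfZ q r) + C (constantCoeff H) := by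
    conv_lhs => rw [eq_X_mul_shift_add_const H]
    rw [subst_add hx, subst_mul hx, subst_X hx]
    congr 1
    exact subst_C _
  induction n generalizing H with
  | zero =>
    rw [pow_zero, one_mul, coeff_zero_eq_constantCoeff_apply, map_mul, hdec, map_add, map_mul,
      constantCoeff_xOfZ]
    simp [hN]
  | succ n ih =>
    have hx2 : xOfZ q r * expPow (q * r) = X := by
      rw [xOfZ, mul_assoc, exp_subst_neg_pow_mul hN, mul_one]
    -- Splitting off the constant term of `H` leaves a factor x(z), which absorbs one power of
    -- e^{z^N} to become z. The constant term itself contributes nothing in positive degree.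
    have : H.subst (xOfZ q r) *
        (expPow (q * r) ^ (n + 1) * (1 - ((q * r : ℕ) : PowerSeries ℚ) * X ^ (q * r)))
        = X * ((mk fun p => coeff (p + 1) H).subst (xOfZ q r) *
          (expPow (q * r) ^ n * (1 - ((q * r : ℕ) : PowerSeries ℚ) * X ^ (q * r))))
          + C (constantCoeff H) *
            (expPow (q * r) ^ (n + 1) * (1 - ((q * r : ℕ) : PowerSeries ℚ) * X ^ (q * r))) := by
      rw [← hx2, hdec]
      ring
    rw [this, map_add, coeff_succ_X_mul, ih, coeff_C_mul, coeff_expPow_pow_mul hN n.succ_ne_zero,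
      mul_zero, add_zero, coeff_mk]

/-- The series `1 / (1 - q r z^{qr})`, so that `x dz/dx = z / (1 - q r z^{qr})`. -/
def zFactor : PowerSeries ℚ := (1 - ((q * r : ℕ) : PowerSeries ℚ) * zSeries q r ^ (q * r))⁻¹

theorem zFactor_mul :
    zFactor q r * (1 - ((q * r : ℕ) : PowerSeries ℚ) * zSeries q r ^ (q * r)) = 1 :=
  PowerSeries.inv_mul_cancel _ (by
    simp [constantCoeff_zSeries, NeZero.ne q, NeZero.ne r])

/-- Obtained by differentiating z e^{-z^N} = x. -/
theorem X_mul_derivative_zSeries :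
    X * d⁄dX ℚ (zSeries q r) = zSeries q r * zFactor q r := by
  have hN := mul_ne_zero_of_neZero q r
  set z := zSeries q r with hz
  set E : PowerSeries ℚ := (exp ℚ).subst (-z ^ (q * r) : PowerSeries ℚ) with hE
  have hzE : z * E = X := zSeries_spec q r
  have hdE : d⁄dX ℚ E = E * -(((q * r : ℕ) : PowerSeries ℚ) * z ^ (q * r - 1) * d⁄dX ℚ z) := by
    rw [hE, derivative_subst (hasSubst_neg_pow q r (constantCoeff_zSeries q r)), derivative_exp,
      map_neg, derivative_pow]
  have h1 := congrArg (d⁄dX ℚ) hzE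
  rw [Derivation.leibniz, derivative_X, hdE, smul_eq_mul, smul_eq_mul] at h1
  have hzN : z * z ^ (q * r - 1) = z ^ (q * r) := by
    rw [← pow_succ', Nat.sub_add_cancel (Nat.one_le_iff_ne_zero.2 hN)]
  have h2 : E * d⁄dX ℚ z * (1 - ((q * r : ℕ) : PowerSeries ℚ) * z ^ (q * r)) = 1 := by
    linear_combination h1 + E * d⁄dX ℚ z * ((q * r : ℕ) : PowerSeries ℚ) * hzN
  have h3 := zFactor_mul q r
  rw [← hz] at h3
  rw [← hzE]
  calc z * E * d⁄dX ℚ z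
      = z * E * d⁄dX ℚ z *
        (zFactor q r * (1 - ((q * r : ℕ) : PowerSeries ℚ) * z ^ (q * r))) := by rw [h3, mul_one]
    _ = z * (E * d⁄dX ℚ z * (1 - ((q * r : ℕ) : PowerSeries ℚ) * z ^ (q * r))) * zFactor q r := by
        ring
    _ = z * zFactor q r := by rw [h2, mul_one]

/-- The coefficients of `z^i / (1 - N z^N)` as a power series in `x = z e^{-z^N}`. -/
def lagrangeCoeff (N i n : ℕ) : ℚ :=
  if i ≤ n ∧ N ∣ n - i then (n : ℚ) ^ ((n - i) / N) / (((n - i) / N)! : ℚ) else 0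

/-- The factor 1 / (1 - N z^N) cancels the Jacobian factor in the inversion formula, leaving the
coefficient of z^n in z^i e^{n z^N}. -/
theorem coeff_zSeries_pow_mul (i n : ℕ) :
    coeff n (zSeries q r ^ i * zFactor q r) = lagrangeCoeff (q * r) i n := by
  have hN := mul_ne_zero_of_neZero q r
  have hx := hasSubst_xOfZ q r
  have hz : (zSeries q r).subst (xOfZ q r) = X :=
    subst_substInvOfIsUnit_left _ (constantCoeff_xOfZ q r) _
  have hf : (zFactor q r).subst (xOfZ q r) * (1 - ((q * r : ℕ) : PowerSeries ℚ) * X ^ (q * r))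
      = 1 := by
    have := congrArg (fun f => f.subst (xOfZ q r)) (zFactor_mul q r)
    simp only [← coe_substAlgHom hx, map_mul, map_sub, map_one, map_pow, map_natCast] at this
    simpa only [coe_substAlgHom hx, hz] using this
  rw [← coeff_subst_xOfZ_mul q r n, subst_mul hx, subst_pow hx, hz,
    show X ^ i * (zFactor q r).subst (xOfZ q r) *
      (expPow (q * r) ^ n * (1 - ((q * r : ℕ) : PowerSeries ℚ) * X ^ (q * r)))
      = X ^ i * expPow (q * r) ^ n * ((zFactor q r).subst (xOfZ q r) *
        (1 - ((q * r : ℕ) : PowerSeries ℚ) * X ^ (q * r))) by ring, hf, mul_one, coeff_X_pow_mul',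
    coeff_expPow_pow hN, lagrangeCoeff]
  split_ifs <;> tauto

/-- Here x d/dx of z^i equals i z^i / (1 - N z^N). The factor `n` is kept on the left to avoid
dividing at `n = 0`. -/
theorem coeff_zSeries_pow (i n : ℕ) :
    n * coeff n (zSeries q r ^ i) = i * lagrangeCoeff (q * r) i n := by
  rcases Nat.eq_zero_or_pos i with rfl | hi
  · rcases Nat.eq_zero_or_pos n with rfl | hn
    · simp
    · simp [coeff_one, hn.ne']
  rw [← coeff_zSeries_pow_mul, ← coeff_X_mul_derivative, derivative_pow]
  have : X * ((i : PowerSeries ℚ) * zSeries q r ^ (i - 1) * d⁄dX ℚ (zSeries q r))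
      = C (i : ℚ) * (zSeries q r ^ i * zFactor q r) := by
    have h2 : zSeries q r ^ i = zSeries q r ^ (i - 1) * zSeries q r := by
      rw [← pow_succ, Nat.sub_add_cancel hi]
    calc X * ((i : PowerSeries ℚ) * zSeries q r ^ (i - 1) * d⁄dX ℚ (zSeries q r))
        = (i : PowerSeries ℚ) * zSeries q r ^ (i - 1) * (X * d⁄dX ℚ (zSeries q r)) := by ring
      _ = _ := by rw [X_mul_derivative_zSeries, h2]; simp; ring
  rw [this, coeff_C_mul]

end Univariate

/-! ### Specialization to the diagonal -/

theorem hasSubst_diagonal (n : ℕ) :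
    MvPowerSeries.HasSubst (fun _ : Fin n => (PowerSeries.X : PowerSeries ℚ)) :=
  MvPowerSeries.hasSubst_of_constantCoeff_zero (fun _ => by exact PowerSeries.constantCoeff_X)

theorem coeff_diagonal {n : ℕ} (f : MvPowerSeries (Fin n) ℚ) (k : ℕ) :
    PowerSeries.coeff k (diagonal f)
      = ∑ᶠ d : Fin n →₀ ℕ, if k = ∑ i, d i then MvPowerSeries.coeff d f else 0 := by
  rw [diagonal, PowerSeries.coeff, MvPowerSeries.coeff_subst (hasSubst_diagonal n)]
  refine finsum_congr fun d => ?_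
  have h : (d.prod fun _ e => (PowerSeries.X : PowerSeries ℚ) ^ e) = PowerSeries.X ^ (∑ i, d i) := by
    rw [Finsupp.prod_fintype _ _ (fun _ => pow_zero _), Finset.prod_pow_eq_pow_sum]
  rw [h]
  have h2 := PowerSeries.coeff_X_pow (R := ℚ) k (∑ i, d i)
  rw [PowerSeries.coeff] at h2
  rw [h2]
  simp

theorem coeff_diagonal_one (f : MvPowerSeries (Fin 1) ℚ) (k : ℕ) :
    PowerSeries.coeff k (diagonal f) = MvPowerSeries.coeff (Finsupp.single 0 k) f := by
  rw [coeff_diagonal, finsum_eq_single _ (Finsupp.single 0 k)]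
  · simp
  · intro d hd
    rw [if_neg]
    rintro rfl
    exact hd (Finsupp.ext fun i => by simp [Subsingleton.elim i 0])

open Finset in
theorem coeff_diagonal_two (f : MvPowerSeries (Fin 2) ℚ) (k : ℕ) :
    PowerSeries.coeff k (diagonal f)
      = ∑ p ∈ antidiagonal k,
        MvPowerSeries.coeff (Finsupp.single 0 p.1 + Finsupp.single 1 p.2) f := by
  classical
  have hinj : Set.InjOn (fun p : ℕ × ℕ => (Finsupp.single 0 p.1 + Finsupp.single 1 p.2 : Fin 2 →₀ ℕ))
      (antidiagonal k) := by
    rintro ⟨a, b⟩ _ ⟨c, d⟩ _ h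
    have h0 := DFunLike.congr_fun h 0
    have h1 := DFunLike.congr_fun h 1
    simp at h0 h1
    rw [h0, h1]
  rw [coeff_diagonal, finsum_eq_sum_of_support_subset (s := (antidiagonal k).image
    fun p => (Finsupp.single 0 p.1 + Finsupp.single 1 p.2 : Fin 2 →₀ ℕ)), sum_image hinj]
  · refine sum_congr rfl fun p hp => if_pos ?_
    simpa using (HasAntidiagonal.mem_antidiagonal.1 hp).symm
  · intro d hd
    have hk : k = ∑ i, d i := by
      by_contra h
      exact hd (if_neg h)
    rw [Fin.sum_univ_two] at hk
    refine mem_coe.2 (mem_image.2 ⟨(d 0, d 1), HasAntidiagonal.mem_antidiagonal.2 hk.symm, ?_⟩)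
    ext i
    fin_cases i <;> simp

/-! ### The operators `D` -/

theorem coeff_X_mul {n : ℕ} (i : Fin n) (f : MvPowerSeries (Fin n) ℚ) (e : Fin n →₀ ℕ) :
    MvPowerSeries.coeff e (MvPowerSeries.X i * f)
      = if 0 < e i then MvPowerSeries.coeff (e - Finsupp.single i 1) f else 0 := by
  classical
  rw [MvPowerSeries.X_def, MvPowerSeries.coeff_monomial_mul]
  simp only [one_mul]
  refine if_congr ?_ rfl rfl
  rw [Finsupp.single_le_iff]
  exact Nat.one_le_iff_ne_zero.trans Nat.pos_iff_ne_zero.symm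

theorem coeff_D {n : ℕ} (i : Fin n) (f : MvPowerSeries (Fin n) ℚ) (e : Fin n →₀ ℕ) :
    MvPowerSeries.coeff e (D i f) = e i * MvPowerSeries.coeff e f := by
  rw [D, coeff_X_mul]
  split_ifs with h
  · have h2 : e - Finsupp.single i 1 + Finsupp.single i 1 = e :=
      tsub_add_cancel_of_le (Finsupp.single_le_iff.2 h)
    rw [MvPowerSeries.coeff_pderiv, h2, Finsupp.tsub_apply, Finsupp.single_eq_same,
      Nat.cast_sub h]
    push_cast
    ring
  · rw [Nat.eq_zero_of_not_pos h]
    simp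

theorem D_mul {n : ℕ} (i : Fin n) (f g : MvPowerSeries (Fin n) ℚ) :
    D i (f * g) = f * D i g + D i f * g := by
  simp only [D, Derivation.leibniz, smul_eq_mul]
  ring

theorem D_sub {n : ℕ} (i : Fin n) (f g : MvPowerSeries (Fin n) ℚ) :
    D i (f - g) = D i f - D i g := by
  simp only [D, map_sub, mul_sub]

theorem D_add {n : ℕ} (i : Fin n) (f g : MvPowerSeries (Fin n) ℚ) :
    D i (f + g) = D i f + D i g := by
  simp only [D, map_add, mul_add]

theorem D_X_self {n : ℕ} (i : Fin n) :
    D i (MvPowerSeries.X i : MvPowerSeries (Fin n) ℚ) = MvPowerSeries.X i := by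
  simp [D]

theorem D_X_of_ne {n : ℕ} {i j : Fin n} (h : j ≠ i) :
    D i (MvPowerSeries.X j : MvPowerSeries (Fin n) ℚ) = 0 := by
  simp [D, h]

/-- The one-part numbers q n^{b-2} / b! with n = q + q r b are, after one application of D_x, the
Lagrange coefficients of z^q. -/
theorem ySeries_eq (q r : ℕ) [NeZero q] [NeZero r] : ySeries q r = zSeries q r ^ q := by
  have hq := Nat.pos_of_ne_zero (NeZero.ne q)
  have hr := Nat.pos_of_ne_zero (NeZero.ne r)
  ext n
  rw [ySeries, coeff_diagonal_one, coeff_D, coeff_correlator_one hq hr, Finsupp.single_eq_same]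
  rcases Nat.eq_zero_or_pos n with rfl | hn
  · simp [constantCoeff_zSeries, hq.ne']
  have hn' : (n : ℚ) ≠ 0 := by exact_mod_cast hn.ne'
  refine mul_left_cancel₀ hn' ?_
  rw [coeff_zSeries_pow, lagrangeCoeff]
  split_ifs with h
  · have := Nat.factorial_ne_zero ((n - q) / (q * r))
    field_simp
  · simp

end

end SpinHurwitz

namespace SpinHurwitz

noncomputable section

open scoped Nat

/-! ### Series in one of two variables -/

section InVar

/-- `inVar i` as an algebra homomorphism. -/
def inVarHom (i : Fin 2) : PowerSeries ℚ →ₐ[ℚ] MvPowerSeries (Fin 2) ℚ :=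
  PowerSeries.substAlgHom (PowerSeries.HasSubst.X i)

theorem inVarHom_apply (i : Fin 2) (f : PowerSeries ℚ) : inVarHom i f = inVar i f := by
  rw [inVarHom, PowerSeries.coe_substAlgHom, inVar]

theorem inVar_mul (i : Fin 2) (f g : PowerSeries ℚ) : inVar i (f * g) = inVar i f * inVar i g := by
  simp only [← inVarHom_apply, map_mul]

theorem inVar_pow (i : Fin 2) (f : PowerSeries ℚ) (n : ℕ) : inVar i (f ^ n) = inVar i f ^ n := by
  simp only [← inVarHom_apply, map_pow]

theorem coeff_inVar (i : Fin 2) (f : PowerSeries ℚ) (e : Fin 2 →₀ ℕ) :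
    MvPowerSeries.coeff e (inVar i f)
      = if e = Finsupp.single i (e i) then PowerSeries.coeff (e i) f else 0 :=
  PowerSeries.coeff_subst_single i f e

theorem coeff_inVar_mul_inVar (f g : PowerSeries ℚ) (e : Fin 2 →₀ ℕ) :
    MvPowerSeries.coeff e (inVar 0 f * inVar 1 g)
      = PowerSeries.coeff (e 0) f * PowerSeries.coeff (e 1) g := by
  classical
  rw [MvPowerSeries.coeff_mul, Finset.sum_eq_single (Finsupp.single 0 (e 0), Finsupp.single 1 (e 1))]
  · simp [coeff_inVar]
  · rintro ⟨a, b⟩ hab hne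
    rw [coeff_inVar, coeff_inVar]
    split_ifs with h0 h1
    · refine absurd ?_ hne
      rw [Finset.HasAntidiagonal.mem_antidiagonal] at hab
      dsimp only at hab h0 h1
      rw [← hab, h0, h1]
      simp
    all_goals simp
  · intro h
    refine absurd (Finset.HasAntidiagonal.mem_antidiagonal.2 ?_) h
    ext i
    fin_cases i <;> simp

theorem D_inVar_self (i : Fin 2) (f : PowerSeries ℚ) :
    D i (inVar i f) = inVar i (PowerSeries.X * PowerSeries.derivative ℚ f) := by
  ext e
  rw [coeff_D, coeff_inVar, coeff_inVar, coeff_X_mul_derivative]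
  split_ifs <;> simp

theorem D_inVar_of_ne {i j : Fin 2} (h : j ≠ i) (f : PowerSeries ℚ) : D j (inVar i f) = 0 := by
  ext e
  rw [coeff_D, coeff_inVar]
  split_ifs with he
  · rw [he]
    simp [h]
  · simp

end InVar

/-! ### The divided difference of a power series -/

/-- The series `(f(x₁) - f(x₂)) / (x₁ - x₂)`. -/
def divDiff (f : PowerSeries ℚ) : MvPowerSeries (Fin 2) ℚ :=
  fun e => PowerSeries.coeff (e 0 + e 1 + 1) f

theorem coeff_divDiff (f : PowerSeries ℚ) (e : Fin 2 →₀ ℕ) :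
    MvPowerSeries.coeff e (divDiff f) = PowerSeries.coeff (e 0 + e 1 + 1) f := rfl

/-- The coefficients of `divDiff f` depend only on total degree, so the two shifted series cancel
whenever both exponents are positive. -/
theorem X_sub_X_mul_divDiff (f : PowerSeries ℚ) :
    (MvPowerSeries.X 0 - MvPowerSeries.X 1) * divDiff f = inVar 0 f - inVar 1 f := by
  ext e
  rw [sub_mul, map_sub, map_sub, coeff_X_mul, coeff_X_mul, coeff_inVar, coeff_inVar,
    coeff_divDiff, coeff_divDiff]
  simp only [Finsupp.tsub_apply, Finsupp.single_eq_same]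
  have h0 : e = Finsupp.single 0 (e 0) ↔ e 1 = 0 := by
    constructor
    · intro h
      rw [h]
      simp
    · intro h
      ext i
      fin_cases i <;> simp [h]
  have h1 : e = Finsupp.single 1 (e 1) ↔ e 0 = 0 := by
    constructor
    · intro h
      rw [h]
      simp
    · intro h
      ext i
      fin_cases i <;> simp [h]
  simp only [h0, h1]
  rw [Finsupp.single_eq_of_ne (by decide), Finsupp.single_eq_of_ne (by decide)]
  rcases Nat.eq_zero_or_pos (e 0) with h | h <;> rcases Nat.eq_zero_or_pos (e 1) with h' | h'
  · simp [h, h']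
  · rw [h]
    simp [h', h'.ne', Nat.sub_add_cancel h']
  · rw [h']
    simp [h, h.ne', Nat.sub_add_cancel h]
  · rw [if_pos h, if_pos h', if_neg h'.ne', if_neg h.ne', tsub_zero, tsub_zero,
      show e 0 - 1 + e 1 + 1 = e 0 + (e 1 - 1) + 1 by omega, sub_self, sub_zero]

/-! ### The chain rule for substitution into a series in several variables -/

theorem eq_zero_of_forall_pow_dvd {σ : Type*} {U W : MvPowerSeries σ ℚ}
    (hU : MvPowerSeries.constantCoeff U = 0) (h : ∀ n, U ^ n ∣ W) : W = 0 := by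
  classical
  ext e
  obtain ⟨V, rfl⟩ := h (e.degree + 1)
  rw [MvPowerSeries.coeff_mul, Finset.sum_eq_zero, map_zero]
  rintro ⟨a, b⟩ hab
  rw [Finset.HasAntidiagonal.mem_antidiagonal] at hab
  rw [MvPowerSeries.coeff_eq_zero_of_constantCoeff_nilpotent (m := 1) (by rw [hU, pow_one]),
    zero_mul]
  rw [← hab, map_add]
  dsimp only
  omega

/-- Removing the constant term of `f` and dividing by the variable shows that the defect of the
chain rule for `f` is `U` times the defect for the shifted series. Hence the defect is divisible by
every power of `U` and vanishes. -/
theorem pderiv_subst {σ : Type*} (i : σ) {U : MvPowerSeries σ ℚ}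
    (hU : MvPowerSeries.constantCoeff U = 0) (f : PowerSeries ℚ) :
    MvPowerSeries.pderiv ℚ i (f.subst U)
      = (PowerSeries.derivative ℚ f).subst U * MvPowerSeries.pderiv ℚ i U := by
  have hs : PowerSeries.HasSubst U := PowerSeries.HasSubst.of_constantCoeff_zero hU
  set Δ : PowerSeries ℚ → MvPowerSeries σ ℚ := fun f => MvPowerSeries.pderiv ℚ i (f.subst U)
    - (PowerSeries.derivative ℚ f).subst U * MvPowerSeries.pderiv ℚ i U with hΔ
  have hstep (f : PowerSeries ℚ) :
      Δ f = U * Δ (PowerSeries.mk fun p => PowerSeries.coeff (p + 1) f) := by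
    set g := PowerSeries.mk fun p => PowerSeries.coeff (p + 1) f with hg
    have h1 : f.subst U
        = U * g.subst U + MvPowerSeries.C (PowerSeries.constantCoeff f) := by
      conv_lhs => rw [PowerSeries.eq_X_mul_shift_add_const f]
      rw [PowerSeries.subst_add hs, PowerSeries.subst_mul hs, PowerSeries.subst_X hs]
      congr 1
      exact PowerSeries.subst_C _
    have h2 : (PowerSeries.derivative ℚ f).subst U
        = U * (PowerSeries.derivative ℚ g).subst U + g.subst U := by
      conv_lhs => rw [PowerSeries.eq_X_mul_shift_add_const f]
      rw [map_add, Derivation.leibniz, PowerSeries.derivative_C, PowerSeries.derivative_X, add_zero,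
        smul_eq_mul, smul_eq_mul, mul_one, PowerSeries.subst_add hs, PowerSeries.subst_mul hs,
        PowerSeries.subst_X hs]
    simp only [hΔ]
    rw [h1, h2, map_add, Derivation.leibniz, MvPowerSeries.pderiv_C, smul_eq_mul, smul_eq_mul]
    ring
  have hdvd : ∀ n f, U ^ n ∣ Δ f := by
    intro n
    induction n with
    | zero => simp
    | succ n ih =>
      intro f
      rw [hstep, pow_succ']
      exact mul_dvd_mul_left _ (ih _)
  exact sub_eq_zero.1 (eq_zero_of_forall_pow_dvd hU fun n => hdvd n f)

theorem mul_D_log {n : ℕ} (i : Fin n) {Q : MvPowerSeries (Fin n) ℚ}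
    (hQ : MvPowerSeries.constantCoeff Q = 1) :
    Q * D i ((PowerSeries.log ℚ).subst (Q - 1)) = D i Q := by
  have hU : MvPowerSeries.constantCoeff (Q - 1) = 0 := by simp [hQ]
  have hs : PowerSeries.HasSubst (Q - 1) := PowerSeries.HasSubst.of_constantCoeff_zero hU
  have h1 : (1 + PowerSeries.X : PowerSeries ℚ) * PowerSeries.derivative ℚ (PowerSeries.log ℚ)
      = 1 := by
    rw [PowerSeries.deriv_log, add_mul, one_mul]
    ext k
    rcases k with _ | k
    · simp
    · rw [map_add, PowerSeries.coeff_succ_X_mul, PowerSeries.coeff_mk, PowerSeries.coeff_mk]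
      simp [pow_succ, PowerSeries.coeff_one]
  have h2 : Q * (PowerSeries.derivative ℚ (PowerSeries.log ℚ)).subst (Q - 1) = 1 := by
    have := congrArg (fun f => f.subst (Q - 1)) h1
    simp only [← PowerSeries.coe_substAlgHom hs, map_mul, map_add, map_one] at this
    rw [PowerSeries.substAlgHom_X hs, add_sub_cancel] at this
    simpa only [PowerSeries.coe_substAlgHom hs] using this
  rw [D, D, pderiv_subst i hU, map_sub, ← map_one MvPowerSeries.C, MvPowerSeries.pderiv_C, sub_zero,
    map_one]
  linear_combination MvPowerSeries.X i * MvPowerSeries.pderiv ℚ i Q * h2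

end

end SpinHurwitz

namespace SpinHurwitz

noncomputable section

open scoped Nat

/-! ### The two-point function in genus zero -/

/-- Since m + n = N b, one has (m + n)(n - N c) = N (n (b - c) - m c), which makes each term a
difference of consecutive values of the right-hand side. -/
theorem sum_telescope {N b : ℕ} {m n : ℚ} (h : m + n = N * b) {K : ℕ} (hK : K < b) :
    (m + n) * ∑ c ∈ Finset.range (K + 1),
        (n - N * c) * (m ^ (b - c) / ((b - c)! : ℚ) * (n ^ c / (c ! : ℚ)))
      = N * (m ^ (b - K) / ((b - K - 1)! : ℚ) * (n ^ (K + 1) / (K ! : ℚ))) := by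
  induction K with
  | zero =>
    obtain ⟨b, rfl⟩ := Nat.exists_eq_succ_of_ne_zero hK.ne'
    have h2 : (b ! : ℚ) ≠ 0 := by exact_mod_cast b.factorial_ne_zero
    have h3 : ((b : ℚ) + 1) ≠ 0 := by positivity
    simp only [zero_add, Finset.sum_range_one, Nat.sub_zero, Nat.succ_sub_one, Nat.succ_eq_add_one,
      Nat.factorial_succ]
    rw [h]
    push_cast
    field_simp
    simp
  | succ K ih =>
    rw [Finset.sum_range_succ, mul_add, ih (by omega)]
    obtain ⟨k, rfl⟩ := Nat.exists_eq_add_of_lt hK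
    rw [show K + 1 + k + 1 - (K + 1) - 1 = k by omega, show K + 1 + k + 1 - (K + 1) = k + 1 by omega,
      show K + 1 + k + 1 - K - 1 = k + 1 by omega, show K + 1 + k + 1 - K = k + 2 by omega]
    have h2 : (k ! : ℚ) ≠ 0 := by exact_mod_cast k.factorial_ne_zero
    have h3 : ((k : ℚ) + 1) ≠ 0 := by positivity
    have h4 : (K ! : ℚ) ≠ 0 := by exact_mod_cast K.factorial_ne_zero
    have h5 : ((K : ℚ) + 1) ≠ 0 := by positivity
    rw [Nat.factorial_succ, Nat.factorial_succ]
    have h6 : (m + n) * (n - N * (K + 1 : ℕ)) = N * (n * (k + 1) - m * (K + 1)) := by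
      rw [h]
      push_cast at h ⊢
      linear_combination (N * (K + 1 : ℚ)) * h
    rw [← mul_assoc (m + n), h6]
    push_cast
    field_simp
    ring

open Finset in
-- `M` is the last index with `N * M < n`, so the positivity condition truncates the sum to `range
-- (M + 1)`; division by `m * n` lowers both exponents in the telescoped value.
theorem sum_two_point {N b M m n : ℕ} (hm : 0 < m) (hn : 0 < n) (h : m + n = N * b)
    (hM : N * M < n) (hM' : n ≤ N * (M + 1)) :
    ((m : ℚ) + n) * ∑ p ∈ antidiagonal b, (if N * p.2 < n then (n : ℚ) - N * p.2 else 0) *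
          ((m : ℚ) ^ p.1 / (p.1 ! : ℚ) * ((n : ℚ) ^ p.2 / (p.2 ! : ℚ))) / (m * n)
      = N * ((m : ℚ) ^ (b - M - 1) / ((b - M - 1)! : ℚ) * ((n : ℚ) ^ M / (M ! : ℚ))) := by
  have hMb : M < b := by
    by_contra hlt
    have : N * b ≤ N * M := Nat.mul_le_mul_left N (not_lt.1 hlt)
    omega
  have hm0 : (m : ℚ) ≠ 0 := by exact_mod_cast hm.ne'
  have hn0 : (n : ℚ) ≠ 0 := by exact_mod_cast hn.ne'
  have hS : ∑ p ∈ antidiagonal b, (if N * p.2 < n then (n : ℚ) - N * p.2 else 0) *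
          ((m : ℚ) ^ p.1 / (p.1 ! : ℚ) * ((n : ℚ) ^ p.2 / (p.2 ! : ℚ))) / (m * n)
      = (∑ c ∈ range (M + 1),
        ((n : ℚ) - N * c) * ((m : ℚ) ^ (b - c) / ((b - c)! : ℚ) * ((n : ℚ) ^ c / (c ! : ℚ))))
          / (m * n) := by
    rw [← Nat.sum_antidiagonal_swap, Nat.sum_antidiagonal_eq_sum_range_succ_mk, sum_div]
    refine (sum_subset (range_mono (show M + 1 ≤ b.succ by omega)) fun c _ hc => ?_).symm.trans
      (sum_congr rfl fun c hc => ?_)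
    · rw [mem_range, not_lt] at hc
      have : N * (M + 1) ≤ N * c := Nat.mul_le_mul_left N hc
      simp [show ¬ N * c < n by omega]
    · rw [mem_range] at hc
      have : N * c ≤ N * M := Nat.mul_le_mul_left N (by omega)
      simp [show N * c < n by omega]
  rw [hS, ← mul_div_assoc, sum_telescope (by exact_mod_cast h) hMb]
  have e : b - M = b - M - 1 + 1 := by omega
  rw [e, Nat.add_sub_cancel, pow_succ, pow_succ]
  field_simp

theorem lagrangeCoeff_add_mul {N : ℕ} (hN : 0 < N) (i k : ℕ) :
    lagrangeCoeff N i (i + N * k) = ((i + N * k : ℕ) : ℚ) ^ k / (k ! : ℚ) := by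
  rw [lagrangeCoeff, if_pos ⟨Nat.le_add_right _ _, by simp⟩, Nat.add_sub_cancel_left,
    Nat.mul_div_cancel_left _ hN]

theorem exists_eq_of_lagrangeCoeff_ne_zero {N i n : ℕ} (h : lagrangeCoeff N i n ≠ 0) :
    ∃ k, n = i + N * k := by
  rw [lagrangeCoeff] at h
  obtain ⟨h1, k, hk⟩ := (ite_ne_right_iff.1 h).1
  exact ⟨k, by omega⟩

/-- A Lagrange coefficient of index `i` at `n` requires `n ≡ i` modulo `N`, so the residue of `n`
selects at most one product. The floor of `(n - 1) / N` is the `M` of `sum_two_point`. -/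
theorem lagrangeCoeff_two_point {N m n : ℕ} (hN : 0 < N) (hm : 0 < m) (hn : 0 < n) :
    lagrangeCoeff N 0 m * lagrangeCoeff N 0 n
        + N * ∑ i ∈ Finset.range (N - 1), lagrangeCoeff N (i + 1) m * lagrangeCoeff N (N - 1 - i) n
      = if N ∣ m + n then
          N * ((m : ℚ) ^ ((m + n) / N - (n - 1) / N - 1) / (((m + n) / N - (n - 1) / N - 1)! : ℚ)
            * ((n : ℚ) ^ ((n - 1) / N) / (((n - 1) / N)! : ℚ)))
        else 0 := by
  have hN0 : (N : ℚ) ≠ 0 := by exact_mod_cast hN.ne'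
  split_ifs with h
  · obtain ⟨b, hb⟩ := h
    obtain ⟨M, hM⟩ : ∃ M, (n - 1) / N = M := ⟨_, rfl⟩
    have hM1 : N * M ≤ n - 1 := hM ▸ Nat.mul_div_le _ _
    have hM2 : n - 1 < N * (M + 1) := hM ▸ Nat.lt_mul_div_succ _ hN
    have hMb : M < b := by
      by_contra hlt
      have : N * b ≤ N * M := Nat.mul_le_mul_left N (not_lt.1 hlt)
      omega
    obtain ⟨k, rfl⟩ := Nat.exists_eq_add_of_lt hMb
    rw [hM, hb, Nat.mul_div_cancel_left _ hN, show M + k + 1 - M - 1 = k by omega]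
    have e1 : N * (M + k + 1) = N * M + N * k + N := by ring
    have e2 : N * (M + 1) = N * M + N := by ring
    rw [e1] at hb
    rw [e2] at hM2
    -- If `N` divides `n`, only the product with both indices 0 survives; its missing factor `N`
    -- comes from `n / (M + 1) = N`. Otherwise the index `N - 1 - i` must be the residue `n - N *
    -- M`.
    by_cases hj : n = N * M + N
    · have hm' : m = 0 + N * k := by omega
      have hn' : n = 0 + N * (M + 1) := by omega
      rw [Finset.sum_eq_zero, mul_zero, add_zero, hm', lagrangeCoeff_add_mul hN, ← hm', hn',
        lagrangeCoeff_add_mul hN, ← hn', Nat.factorial_succ, pow_succ]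
      · have h4 : (M ! : ℚ) ≠ 0 := by exact_mod_cast M.factorial_ne_zero
        have h5 : ((M : ℚ) + 1) ≠ 0 := by positivity
        have h6 : (n : ℚ) = N * (M + 1) := by rw [hn']; push_cast; ring
        push_cast
        field_simp
        rw [h6]
        ring
      · intro i hi
        rw [Finset.mem_range] at hi
        by_contra h0
        obtain ⟨c, hc⟩ := exists_eq_of_lagrangeCoeff_ne_zero (right_ne_zero_of_mul h0)
        have h7 : N ∣ N - 1 - i := by
          refine (Nat.dvd_add_left (dvd_mul_right N c)).1 ?_
          rw [← hc, hn', zero_add]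
          exact dvd_mul_right _ _
        exact absurd (Nat.le_of_dvd (by omega) h7) (by omega)
    · have hj1 : n - N * M < N := by omega
      rw [Finset.sum_eq_single (N - 1 - (n - N * M))]
      · have h0 : lagrangeCoeff N 0 n = 0 := by
          by_contra h0
          obtain ⟨c, hc⟩ := exists_eq_of_lagrangeCoeff_ne_zero h0
          have h7 : N ∣ n - N * M :=
            (Nat.dvd_sub ⟨c, by omega⟩ (dvd_mul_right N M))
          exact absurd (Nat.le_of_dvd (by omega) h7) (by omega)
        have hm' : m = (N - 1 - (n - N * M) + 1) + N * k := by omega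
        have hn' : n = (N - 1 - (N - 1 - (n - N * M))) + N * M := by omega
        have hA := lagrangeCoeff_add_mul hN (N - 1 - (n - N * M) + 1) k
        have hB := lagrangeCoeff_add_mul hN (N - 1 - (N - 1 - (n - N * M))) M
        rw [← hm'] at hA
        rw [← hn'] at hB
        rw [h0, hA, hB]
        ring
      · intro i hi hne
        rw [Finset.mem_range] at hi
        by_contra h0
        obtain ⟨c, hc⟩ := exists_eq_of_lagrangeCoeff_ne_zero (right_ne_zero_of_mul h0)
        have hcM : c = M := by
          have h7 : c < M + 1 := Nat.lt_of_mul_lt_mul_left (a := N) (by rw [e2]; omega)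
          have h8 : M < c + 1 := Nat.lt_of_mul_lt_mul_left (a := N) (by rw [mul_add]; omega)
          omega
        subst hcM
        omega
      · intro hi
        exact absurd (Finset.mem_range.2 (by omega)) hi
  · have h1 : lagrangeCoeff N 0 m * lagrangeCoeff N 0 n = 0 := by
      by_contra h0
      obtain ⟨a, ha⟩ := exists_eq_of_lagrangeCoeff_ne_zero (left_ne_zero_of_mul h0)
      obtain ⟨c, hc⟩ := exists_eq_of_lagrangeCoeff_ne_zero (right_ne_zero_of_mul h0)
      exact h ⟨a + c, by rw [ha, hc]; ring⟩
    rw [h1, Finset.sum_eq_zero, mul_zero, add_zero]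
    intro i hi
    rw [Finset.mem_range] at hi
    by_contra h0
    obtain ⟨a, ha⟩ := exists_eq_of_lagrangeCoeff_ne_zero (left_ne_zero_of_mul h0)
    obtain ⟨c, hc⟩ := exists_eq_of_lagrangeCoeff_ne_zero (right_ne_zero_of_mul h0)
    exact h ⟨a + c + 1, by rw [mul_add, mul_add]; omega⟩

theorem coeff_correlator_two_pos {q r : ℕ} (hq : 0 < q) (hr : 0 < r) {μ : Fin 2 →₀ ℕ}
    (h0 : 0 < μ 0) (h1 : 0 < μ 1) :
    ((μ 0 : ℚ) + μ 1) * MvPowerSeries.coeff μ (correlator q r 0 2)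
      = lagrangeCoeff (q * r) 0 (μ 0) * lagrangeCoeff (q * r) 0 (μ 1)
        + ((q * r : ℕ) : ℚ) * ∑ i ∈ Finset.range (q * r - 1),
          lagrangeCoeff (q * r) (i + 1) (μ 0) * lagrangeCoeff (q * r) (q * r - 1 - i) (μ 1) := by
  have hN : 0 < q * r := Nat.mul_pos hq hr
  rw [coeff_correlator_two hq hr, lagrangeCoeff_two_point hN h0 h1]
  by_cases h : q * r ∣ μ 0 + μ 1
  · rw [if_pos ⟨h0, h1, h⟩, if_pos h]
    have h2 := sum_two_point h0 h1 (Nat.mul_div_cancel' h).symm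
      (M := (μ 1 - 1) / (q * r)) (by have := Nat.mul_div_le (μ 1 - 1) (q * r); omega)
      (by have := Nat.lt_mul_div_succ (μ 1 - 1) hN; omega)
    rw [← h2]
    push_cast
    rfl
  · rw [if_neg (by tauto), if_neg h, mul_zero]

section

variable (q r : ℕ) [NeZero q] [NeZero r]

theorem coeff_one_zSeries : PowerSeries.coeff 1 (zSeries q r) = 1 := by
  have := coeff_zSeries_pow q r 1 1
  simpa [lagrangeCoeff] using this

theorem constantCoeff_divDiff_zSeries :
    MvPowerSeries.constantCoeff (divDiff (zSeries q r)) = 1 := by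
  rw [← MvPowerSeries.coeff_zero_eq_constantCoeff_apply, coeff_divDiff]
  simpa using coeff_one_zSeries q r

theorem X_sub_X_ne_zero :
    (MvPowerSeries.X 0 - MvPowerSeries.X 1 : MvPowerSeries (Fin 2) ℚ) ≠ 0 := by
  intro h
  have := congrArg (MvPowerSeries.coeff (Finsupp.single 0 1)) h
  rw [map_sub, MvPowerSeries.coeff_index_single_X, MvPowerSeries.coeff_index_single_X] at this
  simp at this

theorem divDiff_zSeries_ne_zero : divDiff (zSeries q r) ≠ 0 := by
  intro h
  have := constantCoeff_divDiff_zSeries q r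
  simp [h] at this

/-- The logarithm of `(z₁ - z₂) / (x₁ - x₂)`. -/
def logDivDiff : MvPowerSeries (Fin 2) ℚ :=
  (PowerSeries.log ℚ).subst (divDiff (zSeries q r) - 1)

theorem D_inVar_zSeries (i : Fin 2) :
    D i (inVar i (zSeries q r)) = inVar i (zSeries q r) * inVar i (zFactor q r) := by
  rw [D_inVar_self, X_mul_derivative_zSeries, inVar_mul]

theorem inVar_zFactor_mul (i : Fin 2) :
    inVar i (zFactor q r) * (1 - ((q * r : ℕ) : MvPowerSeries (Fin 2) ℚ)
      * inVar i (zSeries q r) ^ (q * r)) = 1 := by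
  have := congrArg (inVarHom i) (zFactor_mul q r)
  simpa only [map_mul, map_sub, map_one, map_pow, map_natCast, inVarHom_apply] using this

/-- With a = 1 / (1 - N z^N) the left side is (z₁ a₁ - z₂ a₂) / (z₁ - z₂) - 1. Over the common
denominator its numerator is z₁ - z₂ + N z₁ z₂ (z₁^{N-1} - z₂^{N-1}), which the geometric sum
divides by z₁ - z₂. -/
theorem euler_logDivDiff :
    D 0 (logDivDiff q r) + D 1 (logDivDiff q r)
      = inVar 0 (zFactor q r) * inVar 1 (zFactor q r)
        + ((q * r : ℕ) : MvPowerSeries (Fin 2) ℚ) * ∑ i ∈ Finset.range (q * r - 1),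
          inVar 0 (zSeries q r ^ (i + 1) * zFactor q r)
            * inVar 1 (zSeries q r ^ (q * r - 1 - i) * zFactor q r) - 1 := by
  have hN := mul_ne_zero_of_neZero q r
  set N := q * r with hNdef
  set Q := divDiff (zSeries q r) with hQ
  set z₁ := inVar 0 (zSeries q r) with hz₁
  set z₂ := inVar 1 (zSeries q r) with hz₂
  set a₁ := inVar 0 (zFactor q r) with ha₁
  set a₂ := inVar 1 (zFactor q r) with ha₂
  have hQz : (MvPowerSeries.X 0 - MvPowerSeries.X 1) * Q = z₁ - z₂ := X_sub_X_mul_divDiff _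
  have h0 := congrArg (D 0) hQz
  have h1 := congrArg (D 1) hQz
  rw [D_mul, D_sub, D_sub, D_X_self, D_X_of_ne (by decide), hz₁, D_inVar_zSeries,
    hz₂, D_inVar_of_ne (by decide)] at h0
  rw [D_mul, D_sub, D_sub, D_X_self, D_X_of_ne (by decide), hz₂, D_inVar_zSeries,
    hz₁, D_inVar_of_ne (by decide)] at h1
  have hL0 : Q * D 0 (logDivDiff q r) = D 0 Q := mul_D_log 0 (constantCoeff_divDiff_zSeries q r)
  have hL1 : Q * D 1 (logDivDiff q r) = D 1 Q := mul_D_log 1 (constantCoeff_divDiff_zSeries q r)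
  have hf1 := inVar_zFactor_mul q r 0
  have hf2 := inVar_zFactor_mul q r 1
  have hsum : ∑ i ∈ Finset.range (N - 1),
      inVar 0 (zSeries q r ^ (i + 1) * zFactor q r) * inVar 1 (zSeries q r ^ (N - 1 - i) * zFactor q r)
        = a₁ * a₂ * z₁ * z₂ * ∑ i ∈ Finset.range (N - 1), z₁ ^ i * z₂ ^ (N - 1 - 1 - i) := by
    rw [Finset.mul_sum]
    refine Finset.sum_congr rfl fun i hi => ?_
    rw [Finset.mem_range] at hi
    rw [inVar_mul, inVar_mul, inVar_pow, inVar_pow, show N - 1 - i = N - 1 - 1 - i + 1 by omega]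
    ring
  have hgeom := geom_sum₂_mul z₁ z₂ (N - 1)
  have hp1 : z₁ ^ N = z₁ * z₁ ^ (N - 1) := by
    rw [← pow_succ', Nat.sub_add_cancel (Nat.one_le_iff_ne_zero.2 hN)]
  have hp2 : z₂ ^ N = z₂ * z₂ ^ (N - 1) := by
    rw [← pow_succ', Nat.sub_add_cancel (Nat.one_le_iff_ne_zero.2 hN)]
  rw [hsum]
  set G := ∑ i ∈ Finset.range (N - 1), z₁ ^ i * z₂ ^ (N - 1 - 1 - i) with hG
  rw [← hz₁, ← ha₁, ← hNdef, hp1] at hf1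
  rw [← hz₂, ← ha₂, ← hNdef, hp2] at hf2
  -- The cancelled factor is (x₁ - x₂) Q = z₁ - z₂, so no division is needed.
  refine mul_left_cancel₀ (mul_ne_zero X_sub_X_ne_zero (divDiff_zSeries_ne_zero q r)) ?_
  linear_combination (MvPowerSeries.X 0 - MvPowerSeries.X 1) * hL0
    + (MvPowerSeries.X 0 - MvPowerSeries.X 1) * hL1 + h0 + h1
    - (a₁ * a₂ * (1 + (N : MvPowerSeries (Fin 2) ℚ) * z₁ * z₂ * G)) * hQz
    - (N : MvPowerSeries (Fin 2) ℚ) * a₁ * a₂ * z₁ * z₂ * hgeom - z₁ * a₁ * hf2 + z₂ * a₂ * hf1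

end

end

end SpinHurwitz

/-! ### Closed formulas for H_{0,2} and W_{0,2}. -/

namespace SpinHurwitz

noncomputable section

open scoped Nat

section

variable (q r : ℕ) [NeZero q] [NeZero r]

theorem inVar_ySeries_pow (i : Fin 2) :
    inVar i (ySeries q r) ^ r = inVar i (zSeries q r ^ (q * r)) := by
  rw [ySeries_eq, ← inVar_pow, ← pow_mul]

theorem lagrangeCoeff_zero_right {N i : ℕ} (hi : i ≠ 0) : lagrangeCoeff N i 0 = 0 := by
  rw [lagrangeCoeff, if_neg (by omega)]

theorem lagrangeCoeff_zero_zero (N : ℕ) : lagrangeCoeff N 0 0 = 1 := by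
  simp [lagrangeCoeff]

/-- Away from degree zero, 1 / (1 - N z^N) and N z^N / (1 - N z^N) = x d/dx z^N have the same
coefficients. -/
theorem lagrangeCoeff_zero_left {n : ℕ} (hn : n ≠ 0) :
    lagrangeCoeff (q * r) 0 n = n * PowerSeries.coeff n (zSeries q r ^ (q * r)) := by
  rw [coeff_zSeries_pow]
  have h := congrArg (PowerSeries.coeff n) (zFactor_mul q r)
  rw [show zFactor q r * (1 - ((q * r : ℕ) : PowerSeries ℚ) * zSeries q r ^ (q * r))
    = zSeries q r ^ 0 * zFactor q r - PowerSeries.C ((q * r : ℕ) : ℚ)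
      * (zSeries q r ^ (q * r) * zFactor q r) by rw [map_natCast]; ring, map_sub,
    PowerSeries.coeff_C_mul, coeff_zSeries_pow_mul, coeff_zSeries_pow_mul, PowerSeries.coeff_one,
    if_neg hn] at h
  linear_combination h

theorem coeff_euler_logDivDiff (μ : Fin 2 →₀ ℕ) :
    ((μ 0 : ℚ) + μ 1) * MvPowerSeries.coeff μ (logDivDiff q r)
      = lagrangeCoeff (q * r) 0 (μ 0) * lagrangeCoeff (q * r) 0 (μ 1)
        + ((q * r : ℕ) : ℚ) * (∑ i ∈ Finset.range (q * r - 1),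
          lagrangeCoeff (q * r) (i + 1) (μ 0) * lagrangeCoeff (q * r) (q * r - 1 - i) (μ 1))
        - if μ = 0 then 1 else 0 := by
  classical
  have h := congrArg (MvPowerSeries.coeff μ) (euler_logDivDiff q r)
  rw [map_add, coeff_D, coeff_D, ← add_mul] at h
  rw [h, ← map_natCast MvPowerSeries.C, map_sub, map_add, MvPowerSeries.coeff_C_mul, map_sum,
    coeff_inVar_mul_inVar, MvPowerSeries.coeff_one]
  simp only [coeff_inVar_mul_inVar, coeff_zSeries_pow_mul]
  have h0 (n : ℕ) : PowerSeries.coeff n (zFactor q r) = lagrangeCoeff (q * r) 0 n := by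
    rw [← coeff_zSeries_pow_mul, pow_zero, one_mul]
  rw [h0, h0]

theorem constantCoeff_logDivDiff : MvPowerSeries.constantCoeff (logDivDiff q r) = 0 :=
  PowerSeries.constantCoeff_subst_eq_zero (by simp [constantCoeff_divDiff_zSeries]) _
    PowerSeries.constantCoeff_log

/-- The Euler operator is injective on series without constant term, so coefficients are compared
after multiplying by the total degree. With one exponent zero, the correlator vanishes and the
logarithm contributes exactly the coefficient of z^{qr} = y^r. -/
theorem correlator_two_eq :
    correlator q r 0 2
      = logDivDiff q r - inVar 0 (ySeries q r) ^ r - inVar 1 (ySeries q r) ^ r := by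
  have hq := Nat.pos_of_ne_zero (NeZero.ne q)
  have hr := Nat.pos_of_ne_zero (NeZero.ne r)
  have hN := mul_ne_zero_of_neZero q r
  rw [inVar_ySeries_pow, inVar_ySeries_pow]
  ext μ
  by_cases hμ : μ = 0
  · subst hμ
    rw [coeff_correlator_two hq hr, map_sub, map_sub, coeff_inVar, coeff_inVar,
      MvPowerSeries.coeff_zero_eq_constantCoeff_apply, constantCoeff_logDivDiff]
    simp [constantCoeff_zSeries, hq.ne', hr.ne']
  have hne : (μ 0 : ℚ) + μ 1 ≠ 0 := by
    intro h
    have h' : μ 0 + μ 1 = 0 := by exact_mod_cast h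
    refine hμ (Finsupp.ext (Fin.forall_fin_two.2 ⟨?_, ?_⟩)) <;> simp <;> omega
  refine mul_left_cancel₀ hne ?_
  rw [map_sub, map_sub, mul_sub, mul_sub, coeff_euler_logDivDiff, if_neg hμ, sub_zero, coeff_inVar,
    coeff_inVar]
  have e0 : μ = Finsupp.single 0 (μ 0) ↔ μ 1 = 0 := by
    constructor
    · intro h
      rw [h]
      simp
    · intro h
      ext i
      fin_cases i <;> simp [h]
  have e1 : μ = Finsupp.single 1 (μ 1) ↔ μ 0 = 0 := by
    constructor
    · intro h
      rw [h]
      simp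
    · intro h
      ext i
      fin_cases i <;> simp [h]
  simp only [e0, e1]
  by_cases h0 : μ 0 = 0
  · have h1 : μ 1 ≠ 0 := fun h1 => by simp [h0, h1] at hne
    rw [coeff_correlator_two hq hr, if_neg (by omega), if_neg h1, if_pos h0, h0,
      lagrangeCoeff_zero_zero, Finset.sum_eq_zero fun i _ => by
        rw [lagrangeCoeff_zero_right (by omega), zero_mul], lagrangeCoeff_zero_left q r h1]
    simp
  by_cases h1 : μ 1 = 0
  · rw [coeff_correlator_two hq hr, if_neg (by omega), if_pos h1, if_neg h0, h1,
      lagrangeCoeff_zero_zero, Finset.sum_eq_zero fun i hi => by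
        rw [Finset.mem_range] at hi
        rw [lagrangeCoeff_zero_right (i := q * r - 1 - i) (by omega), mul_zero],
      lagrangeCoeff_zero_left q r h0]
    simp
  · rw [coeff_correlator_two_pos hq hr (Nat.pos_of_ne_zero h0) (Nat.pos_of_ne_zero h1), if_neg h1,
      if_neg h0]
    ring

theorem W02_eq : W02 q r = D 0 (D 1 (logDivDiff q r)) := by
  have hD0 : D 0 (0 : MvPowerSeries (Fin 2) ℚ) = 0 := by simp [D]
  rw [W02, correlator_two_eq, inVar_ySeries_pow, inVar_ySeries_pow]
  simp only [D_sub]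
  rw [D_inVar_of_ne (show (1 : Fin 2) ≠ 0 by decide), D_inVar_self,
    D_inVar_of_ne (show (0 : Fin 2) ≠ 1 by decide), hD0, sub_zero, sub_zero]

/-- Second logarithmic derivative with denominators cleared. In this form it can be restricted to
the diagonal, where x₁ - x₂ vanishes. -/
theorem divDiff_sq_mul_W02 :
    divDiff (zSeries q r) ^ 2 * W02 q r
      = divDiff (zSeries q r) * D 0 (D 1 (divDiff (zSeries q r)))
        - D 0 (divDiff (zSeries q r)) * D 1 (divDiff (zSeries q r)) := by
  have h1 : divDiff (zSeries q r) * D 1 (logDivDiff q r) = D 1 (divDiff (zSeries q r)) :=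
    mul_D_log 1 (constantCoeff_divDiff_zSeries q r)
  have h2 := congrArg (D 0) h1
  rw [D_mul] at h2
  rw [W02_eq]
  linear_combination divDiff (zSeries q r) * h2 - D 0 (divDiff (zSeries q r)) * h1

theorem X_sub_X_sq_mul_W02 :
    ((MvPowerSeries.X 0 - MvPowerSeries.X 1) * divDiff (zSeries q r)) ^ 2 * W02 q r
      = D 0 (inVar 0 (zSeries q r)) * D 1 (inVar 1 (zSeries q r))
        - MvPowerSeries.X 0 * MvPowerSeries.X 1 * divDiff (zSeries q r) ^ 2 := by
  have hW := divDiff_sq_mul_W02 q r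
  set Q := divDiff (zSeries q r) with hQ
  have hQz : (MvPowerSeries.X 0 - MvPowerSeries.X 1) * Q
    = inVar 0 (zSeries q r) - inVar 1 (zSeries q r) := X_sub_X_mul_divDiff _
  have h0 := congrArg (D 0) hQz
  have h1 := congrArg (D 1) hQz
  rw [D_mul, D_sub, D_sub, D_X_self, D_X_of_ne (by decide),
    D_inVar_of_ne (show (0 : Fin 2) ≠ 1 by decide)] at h0
  rw [D_mul, D_sub, D_sub, D_X_self, D_X_of_ne (by decide),
    D_inVar_of_ne (show (1 : Fin 2) ≠ 0 by decide)] at h1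
  have h01 := congrArg (D 0) h1
  have hD0 : D 0 (0 : MvPowerSeries (Fin 2) ℚ) = 0 := by simp [D]
  have hD1 : D 0 (D 1 (inVar 1 (zSeries q r))) = 0 := by
    rw [D_inVar_self, D_inVar_of_ne (by decide)]
  rw [D_add, D_mul, D_mul, D_sub, D_sub, D_sub, D_X_self, D_X_of_ne (by decide), hD0, hD1] at h01
  set X₀ : MvPowerSeries (Fin 2) ℚ := MvPowerSeries.X 0 with hX0
  set X₁ : MvPowerSeries (Fin 2) ℚ := MvPowerSeries.X 1 with hX1
  linear_combination (X₀ - X₁) ^ 2 * hW + (X₀ - X₁) * Q * h01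
    + (X₁ * Q - (X₀ - X₁) * D 1 Q) * h0
    - D 0 (inVar 0 (zSeries q r)) * h1

theorem toFrac_injective : Function.Injective toFrac :=
  IsFractionRing.injective _ _

theorem toFrac_W02 :
    toFrac (W02 q r)
      = toFrac (D 0 (inVar 0 (zSeries q r))) * toFrac (D 1 (inVar 1 (zSeries q r)))
          / (toFrac (inVar 0 (zSeries q r)) - toFrac (inVar 1 (zSeries q r))) ^ 2
        - toFrac (MvPowerSeries.X 0) * toFrac (MvPowerSeries.X 1)
          / (toFrac (MvPowerSeries.X 0) - toFrac (MvPowerSeries.X 1)) ^ 2 := by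
  have h := congrArg toFrac (X_sub_X_sq_mul_W02 q r)
  have hz := congrArg toFrac (X_sub_X_mul_divDiff (zSeries q r))
  simp only [map_mul, map_sub, map_pow] at h hz
  have hX : toFrac (MvPowerSeries.X 0) - toFrac (MvPowerSeries.X 1) ≠ 0 := by
    rw [← map_sub]
    exact (map_ne_zero_iff _ toFrac_injective).2 X_sub_X_ne_zero
  have hQ : toFrac (divDiff (zSeries q r)) ≠ 0 :=
    (map_ne_zero_iff _ toFrac_injective).2 (divDiff_zSeries_ne_zero q r)
  rw [← hz]
  field_simp
  linear_combination h

/-! ### The two-point function on the diagonal -/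

/-- Specialization to the diagonal as an algebra homomorphism. -/
def diagonalHom (n : ℕ) : MvPowerSeries (Fin n) ℚ →ₐ[ℚ] PowerSeries ℚ :=
  MvPowerSeries.substAlgHom (hasSubst_diagonal n)

theorem diagonalHom_apply {n : ℕ} (f : MvPowerSeries (Fin n) ℚ) : diagonalHom n f = diagonal f := by
  rw [diagonalHom, MvPowerSeries.coe_substAlgHom, diagonal]

end

theorem sum_range_id_rat (n : ℕ) :
    ∑ k ∈ Finset.range n, (k : ℚ) = n * (n - 1) / 2 := by
  induction n with
  | zero => simp
  | succ n ih => rw [Finset.sum_range_succ, ih]; push_cast; ring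

theorem sum_range_sq_rat (n : ℕ) :
    ∑ k ∈ Finset.range n, (k : ℚ) ^ 2 = n * (n - 1) * (2 * n - 1) / 6 := by
  induction n with
  | zero => simp
  | succ n ih => rw [Finset.sum_range_succ, ih]; push_cast; ring

open Finset in
theorem sum_antidiagonal_fst (n : ℕ) :
    ∑ p ∈ antidiagonal n, (p.1 : ℚ) = n * (n + 1) / 2 := by
  rw [Nat.sum_antidiagonal_eq_sum_range_succ_mk, sum_range_id_rat]
  push_cast
  ring

open Finset in
theorem sum_antidiagonal_snd (n : ℕ) :
    ∑ p ∈ antidiagonal n, (p.2 : ℚ) = n * (n + 1) / 2 := by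
  rw [← sum_antidiagonal_fst, ← Nat.sum_antidiagonal_swap]
  rfl

open Finset in
theorem sum_antidiagonal_mul (n : ℕ) :
    ∑ p ∈ antidiagonal n, (p.1 : ℚ) * p.2 = (n - 1) * n * (n + 1) / 6 := by
  have h : ∀ p ∈ antidiagonal n, (p.1 : ℚ) * p.2 = n * p.1 - (p.1 : ℚ) ^ 2 := by
    intro p hp
    rw [← HasAntidiagonal.mem_antidiagonal.1 hp]
    push_cast
    ring
  rw [sum_congr rfl h, sum_sub_distrib, ← mul_sum, sum_antidiagonal_fst,
    Nat.sum_antidiagonal_eq_sum_range_succ_mk, sum_range_sq_rat]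
  push_cast
  ring

/-- The Euler operator `x d/dx`. -/
def eulerOp (f : PowerSeries ℚ) : PowerSeries ℚ := PowerSeries.X * PowerSeries.derivative ℚ f

theorem coeff_eulerOp (f : PowerSeries ℚ) (n : ℕ) :
    PowerSeries.coeff n (eulerOp f) = n * PowerSeries.coeff n f := coeff_X_mul_derivative f n

theorem eulerOp_mul (f g : PowerSeries ℚ) : eulerOp (f * g) = eulerOp f * g + f * eulerOp g := by
  rw [eulerOp, eulerOp, eulerOp, Derivation.leibniz, smul_eq_mul, smul_eq_mul]
  ring

theorem eulerOp_pow (f : PowerSeries ℚ) {n : ℕ} (hn : n ≠ 0) :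
    f * eulerOp (f ^ n) = (n : PowerSeries ℚ) * f ^ n * eulerOp f := by
  obtain ⟨m, rfl⟩ := Nat.exists_eq_succ_of_ne_zero hn
  rw [eulerOp, eulerOp, PowerSeries.derivative_pow, Nat.succ_sub_one, Nat.succ_eq_add_one, pow_succ]
  ring

/-- Each of the `n + 1` monomials of degree `n` carries the coefficient of `f` in degree `n + 1`;
the factor `X` realigns the degrees. The next two lemmas weight the monomials by their exponents. -/
theorem X_mul_diagonal_divDiff (f : PowerSeries ℚ) :
    PowerSeries.X * diagonal (divDiff f) = eulerOp f := by
  ext n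
  cases n with
  | zero => simp [eulerOp]
  | succ n =>
    rw [PowerSeries.coeff_succ_X_mul, coeff_diagonal_two, coeff_eulerOp]
    have h : ∀ p ∈ Finset.HasAntidiagonal.antidiagonal n, MvPowerSeries.coeff
        (Finsupp.single 0 p.1 + Finsupp.single 1 p.2) (divDiff f)
          = PowerSeries.coeff (n + 1) f := by
      intro p hp
      rw [coeff_divDiff, ← Finset.HasAntidiagonal.mem_antidiagonal.1 hp]
      simp
    rw [Finset.sum_congr rfl h]
    simp

theorem X_mul_diagonal_D_divDiff (i : Fin 2) (f : PowerSeries ℚ) :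
    PowerSeries.X * diagonal (D i (divDiff f))
      = PowerSeries.C (1 / 2) * (eulerOp (eulerOp f) - eulerOp f) := by
  ext n
  cases n with
  | zero => simp [eulerOp]
  | succ n =>
    rw [PowerSeries.coeff_succ_X_mul, coeff_diagonal_two, PowerSeries.coeff_C_mul, map_sub,
      coeff_eulerOp, coeff_eulerOp]
    have h : ∀ p ∈ Finset.HasAntidiagonal.antidiagonal n, MvPowerSeries.coeff
        (Finsupp.single 0 p.1 + Finsupp.single 1 p.2) (D i (divDiff f))
          = ((Finsupp.single 0 p.1 + Finsupp.single 1 p.2 : Fin 2 →₀ ℕ) i : ℚ)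
            * PowerSeries.coeff (n + 1) f := by
      intro p hp
      rw [coeff_D, coeff_divDiff, ← Finset.HasAntidiagonal.mem_antidiagonal.1 hp]
      simp
    rw [Finset.sum_congr rfl h, ← Finset.sum_mul]
    have h2 : ∑ p ∈ Finset.HasAntidiagonal.antidiagonal n,
        ((Finsupp.single 0 p.1 + Finsupp.single 1 p.2 : Fin 2 →₀ ℕ) i : ℚ)
          = n * (n + 1) / 2 := by
      fin_cases i
      · simpa using sum_antidiagonal_fst n
      · simpa using sum_antidiagonal_snd n
    rw [h2]
    push_cast
    ring

theorem X_mul_diagonal_D_D_divDiff (f : PowerSeries ℚ) :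
    PowerSeries.X * diagonal (D 0 (D 1 (divDiff f)))
      = PowerSeries.C (1 / 6) * (eulerOp (eulerOp (eulerOp f)) - 3 * eulerOp (eulerOp f)
        + 2 * eulerOp f) := by
  rw [show (3 : PowerSeries ℚ) = PowerSeries.C 3 from (map_ofNat PowerSeries.C 3).symm,
    show (2 : PowerSeries ℚ) = PowerSeries.C 2 from (map_ofNat PowerSeries.C 2).symm]
  ext n
  cases n with
  | zero => simp [eulerOp]
  | succ n =>
    rw [PowerSeries.coeff_succ_X_mul, coeff_diagonal_two]
    simp only [PowerSeries.coeff_C_mul, map_sub, map_add, coeff_eulerOp]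
    have h : ∀ p ∈ Finset.HasAntidiagonal.antidiagonal n, MvPowerSeries.coeff
        (Finsupp.single 0 p.1 + Finsupp.single 1 p.2) (D 0 (D 1 (divDiff f)))
          = (p.1 : ℚ) * p.2 * PowerSeries.coeff (n + 1) f := by
      intro p hp
      rw [coeff_D, coeff_D, coeff_divDiff, ← Finset.HasAntidiagonal.mem_antidiagonal.1 hp]
      simp [mul_assoc]
    rw [Finset.sum_congr rfl h, ← Finset.sum_mul, sum_antidiagonal_mul]
    push_cast
    ring

section

variable (q r : ℕ) [NeZero q] [NeZero r]

theorem zSeries_ne_zero : zSeries q r ≠ 0 := by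
  intro h
  have := coeff_one_zSeries q r
  simp [h] at this

theorem zFactor_ne_zero : zFactor q r ≠ 0 := left_ne_zero_of_mul_eq_one (zFactor_mul q r)

theorem eulerOp_zSeries : eulerOp (zSeries q r) = zSeries q r * zFactor q r :=
  X_mul_derivative_zSeries q r

theorem eulerOp_zFactor :
    eulerOp (zFactor q r)
      = ((q * r : ℕ) : PowerSeries ℚ) * (zFactor q r ^ 3 - zFactor q r ^ 2) := by
  have hN := mul_ne_zero_of_neZero q r
  have ha := zFactor_mul q r
  set z := zSeries q r with hz
  set a := zFactor q r with haz
  set N : PowerSeries ℚ := ((q * r : ℕ) : PowerSeries ℚ) with hNdef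
  have h1 : eulerOp (z ^ (q * r)) = N * z ^ (q * r) * a := by
    refine mul_left_cancel₀ (zSeries_ne_zero q r) ?_
    rw [← hz, eulerOp_pow _ hN, eulerOp_zSeries]
    ring
  have h2 : eulerOp (1 - N * z ^ (q * r)) = -(N * (N * z ^ (q * r) * a)) := by
    rw [← h1]
    have hD : PowerSeries.derivative ℚ N = 0 := by
      rw [hNdef, ← map_natCast (PowerSeries.C (R := ℚ)), PowerSeries.derivative_C]
    simp only [eulerOp, map_sub, Derivation.leibniz, hD, smul_eq_mul, Derivation.map_one_eq_zero]
    ring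
  have h3 := congrArg eulerOp ha
  rw [eulerOp_mul, h2] at h3
  have h4 : eulerOp (1 : PowerSeries ℚ) = 0 := by simp [eulerOp]
  rw [h4] at h3
  linear_combination a * h3 - (eulerOp a + N * a ^ 2) * ha

/-- Here 1/t = z^N - 1/N = -(1 - N z^N) / N. -/
theorem tSeries_eq : tSeries q r = -(((q * r : ℕ) : PowerSeries ℚ) * zFactor q r) := by
  have ht := tSeries_mul q r
  have ha := zFactor_mul q r
  have hy : ySeries q r ^ r = zSeries q r ^ (q * r) := by rw [ySeries_eq, ← pow_mul]
  rw [hy] at ht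
  have hc : ((q * r : ℕ) : PowerSeries ℚ) * PowerSeries.C (1 / ((q : ℚ) * r)) = 1 := by
    rw [← map_natCast (PowerSeries.C (R := ℚ)), ← map_mul]
    have h1 : (q : ℚ) ≠ 0 := by exact_mod_cast NeZero.ne q
    have h2 : (r : ℚ) ≠ 0 := by exact_mod_cast NeZero.ne r
    push_cast
    rw [mul_one_div_cancel (mul_ne_zero h1 h2), map_one]
  linear_combination -(((q * r : ℕ) : PowerSeries ℚ) * zFactor q r) * ht
    + -(tSeries q r) * ha - tSeries q r * zFactor q r * hc

theorem diagonal_W02 :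
    12 * diagonal (W02 q r)
      = 3 * ((q * r : ℕ) : PowerSeries ℚ) ^ 2 * zFactor q r ^ 4
        - 4 * ((q * r : ℕ) : PowerSeries ℚ) ^ 2 * zFactor q r ^ 3
        + (((q * r : ℕ) : PowerSeries ℚ) ^ 2 - 1) * zFactor q r ^ 2 + 1 := by
  have hW := congrArg (diagonalHom 2) (divDiff_sq_mul_W02 q r)
  simp only [map_mul, map_sub, map_pow, diagonalHom_apply] at hW
  have hQ := X_mul_diagonal_divDiff (zSeries q r)
  have h0 := X_mul_diagonal_D_divDiff 0 (zSeries q r)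
  have h1 := X_mul_diagonal_D_divDiff 1 (zSeries q r)
  have h01 := X_mul_diagonal_D_D_divDiff (zSeries q r)
  have hz := eulerOp_zSeries q r
  have ha := eulerOp_zFactor q r
  set z := zSeries q r with hzdef
  set a := zFactor q r with hadef
  set N : PowerSeries ℚ := ((q * r : ℕ) : PowerSeries ℚ) with hNdef
  have hDN : PowerSeries.derivative ℚ N = 0 := by
    rw [hNdef, ← map_natCast (PowerSeries.C (R := ℚ)), PowerSeries.derivative_C]
  have hz2 : eulerOp (eulerOp z) = z * (N * a ^ 3 + (1 - N) * a ^ 2) := by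
    rw [hz, eulerOp_mul, hz, ha]
    ring
  have hp : eulerOp (N * a ^ 3 + (1 - N) * a ^ 2)
      = (3 * N * a ^ 2 + 2 * (1 - N) * a) * eulerOp a := by
    simp only [eulerOp, map_add, map_sub, Derivation.leibniz, hDN, PowerSeries.derivative_pow,
      Derivation.map_one_eq_zero, smul_eq_mul]
    push_cast
    ring
  have hz3 : eulerOp (eulerOp (eulerOp z))
      = z * (a * (N * a ^ 3 + (1 - N) * a ^ 2)
        + (3 * N * a ^ 2 + 2 * (1 - N) * a) * (N * (a ^ 3 - a ^ 2))) := by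
    rw [hz2, eulerOp_mul, hz, hp, ha]
    ring
  rw [hz2, hz] at h0 h1
  rw [hz3, hz2, hz] at h01
  rw [hz] at hQ
  have c2 : (2 : PowerSeries ℚ) * PowerSeries.C (1 / 2) = 1 := by
    rw [show (2 : PowerSeries ℚ) = PowerSeries.C 2 from (map_ofNat PowerSeries.C 2).symm, ← map_mul]
    norm_num
  have c6 : (6 : PowerSeries ℚ) * PowerSeries.C (1 / 6) = 1 := by
    rw [show (6 : PowerSeries ℚ) = PowerSeries.C 6 from (map_ofNat PowerSeries.C 6).symm, ← map_mul]
    norm_num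
  set dQ := diagonal (divDiff z) with hdQ
  set d0 := diagonal (D 0 (divDiff z)) with hd0
  set d1 := diagonal (D 1 (divDiff z)) with hd1
  set d01 := diagonal (D 0 (D 1 (divDiff z))) with hd01
  set P2 := N * a ^ 3 + (1 - N) * a ^ 2 - a with hP2
  set P3 := a * (N * a ^ 3 + (1 - N) * a ^ 2)
    + (3 * N * a ^ 2 + 2 * (1 - N) * a) * (N * (a ^ 3 - a ^ 2))
    - 3 * (N * a ^ 3 + (1 - N) * a ^ 2) + 2 * a with hP3
  have k0 : 2 * (PowerSeries.X * d0) = z * P2 := by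
    linear_combination 2 * h0 + z * P2 * c2
  have k1 : 2 * (PowerSeries.X * d1) = z * P2 := by
    linear_combination 2 * h1 + z * P2 * c2
  have k01 : 6 * (PowerSeries.X * d01) = z * P3 := by
    linear_combination 6 * h01 + z * P3 * c6
  -- Multiply `divDiff_sq_mul_W02` on the diagonal by 12 x²: the weights 1/6 and 1/2 · 1/2 become 2
  -- and 3. What then remains is a polynomial identity in `a` and `N`, times `z ^ 2`.
  have key : (z * a) ^ 2 * (12 * diagonal (W02 q r))
      = 2 * (z * a) * (z * P3) - 3 * (z * P2) * (z * P2) := by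
    rw [← hQ, ← k01]
    nth_rewrite 1 [← k0]
    rw [← k1]
    linear_combination 12 * PowerSeries.X ^ 2 * hW
  refine mul_left_cancel₀ (pow_ne_zero 2 (mul_ne_zero (zSeries_ne_zero q r)
    (zFactor_ne_zero q r))) ?_
  rw [← hzdef, ← hadef, key, hP2, hP3]
  ring

theorem diagonal_W02_eq :
    diagonal (W02 q r)
      = PowerSeries.C (1 / (12 * (r : ℚ) ^ 2 * (q : ℚ) ^ 2)) *
          (3 * tSeries q r ^ 4
            + 4 * PowerSeries.C ((q : ℚ) * r) * tSeries q r ^ 3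
            + PowerSeries.C ((q : ℚ) ^ 2 * (r : ℚ) ^ 2 - 1) * tSeries q r ^ 2
            + PowerSeries.C ((q : ℚ) ^ 2 * (r : ℚ) ^ 2)) := by
  have hW := diagonal_W02 q r
  have hc : PowerSeries.C (1 / (12 * (r : ℚ) ^ 2 * (q : ℚ) ^ 2))
      * (12 * ((q * r : ℕ) : PowerSeries ℚ) ^ 2) = 1 := by
    have h1 : (q : ℚ) ≠ 0 := by exact_mod_cast NeZero.ne q
    have h2 : (r : ℚ) ≠ 0 := by exact_mod_cast NeZero.ne r
    rw [← map_natCast (PowerSeries.C (R := ℚ)), show (12 : PowerSeries ℚ) = PowerSeries.C 12 from (map_ofNat PowerSeries.C 12).symm,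
      ← map_pow, ← map_mul, ← map_mul, ← map_one PowerSeries.C]
    congr 1
    push_cast
    field_simp
  have e1 : PowerSeries.C ((q : ℚ) * r) = ((q * r : ℕ) : PowerSeries ℚ) := by
    rw [← map_natCast (PowerSeries.C (R := ℚ))]
    push_cast
    rfl
  have e2 : PowerSeries.C ((q : ℚ) ^ 2 * (r : ℚ) ^ 2) = ((q * r : ℕ) : PowerSeries ℚ) ^ 2 := by
    rw [← mul_pow, map_pow, e1]
  rw [tSeries_eq, map_sub, e1, e2, map_one]
  linear_combination -(diagonal (W02 q r)) * hc
    + PowerSeries.C (1 / (12 * (r : ℚ) ^ 2 * (q : ℚ) ^ 2)) * ((q * r : ℕ) : PowerSeries ℚ) ^ 2 * hW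

end

end

end SpinHurwitz

open SpinHurwitz in
theorem lemma3p4 (q r : ℕ) [NeZero q] [NeZero r] :
    -- `H_{0,2} = ln ((z₁ - z₂) / (x₁ - x₂)) - y₁ ^ r - y₂ ^ r`, where the quotient `Q` is a power
    -- series with constant term `1`, and `ln Q = log (1 + (Q - 1))`
    (∃ Q : MvPowerSeries (Fin 2) ℚ,
      MvPowerSeries.constantCoeff Q = 1 ∧
      (MvPowerSeries.X 0 - MvPowerSeries.X 1) * Q
        = inVar 0 (zSeries q r) - inVar 1 (zSeries q r) ∧
      correlator q r 0 2
        = (PowerSeries.log ℚ).subst (Q - 1)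
          - inVar 0 (ySeries q r) ^ r - inVar 1 (ySeries q r) ^ r) ∧
    -- the formula for `W_{0,2}(x₁, x₂)`, in the field of fractions of `ℚ⟦x₁, x₂⟧`
    (toFrac (W02 q r)
      = toFrac (D 0 (inVar 0 (zSeries q r))) * toFrac (D 1 (inVar 1 (zSeries q r)))
          / (toFrac (inVar 0 (zSeries q r)) - toFrac (inVar 1 (zSeries q r))) ^ 2
        - toFrac (MvPowerSeries.X 0) * toFrac (MvPowerSeries.X 1)
          / (toFrac (MvPowerSeries.X 0) - toFrac (MvPowerSeries.X 1)) ^ 2) ∧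
    -- the formula for `W_{0,2}(x, x)`
    diagonal (W02 q r)
      = PowerSeries.C (1 / (12 * (r : ℚ) ^ 2 * (q : ℚ) ^ 2)) *
          (3 * tSeries q r ^ 4
            + 4 * PowerSeries.C ((q : ℚ) * r) * tSeries q r ^ 3
            + PowerSeries.C ((q : ℚ) ^ 2 * (r : ℚ) ^ 2 - 1) * tSeries q r ^ 2
            + PowerSeries.C ((q : ℚ) ^ 2 * (r : ℚ) ^ 2)) := by
  exact ⟨⟨divDiff (zSeries q r), constantCoeff_divDiff_zSeries q r, X_sub_X_mul_divDiff _,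
    correlator_two_eq q r⟩, toFrac_W02 q r, diagonal_W02_eq q r⟩
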